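/- Let $\mathcal H$ be a finite-dimensional complex Hilbert space of dimension $d$, and let $\mathcal S(\mathcal H)$ be the set of density matrices on $\mathcal H$ (positive semidefinite operators of trace one). Let $\mathcal P=(\mathcal P_t)_{t\ge 0}$ be a quantum Markov semigroup (QMS) on $\mathcal B(\mathcal H)$, that is, a continuous semigroup of completely positive maps with $\mathcal P_0=\mathrm{id}$ and $\mathcal P_t(I)=I$, and let $\mathcal L=\lim_{t\to0^+}\frac1t(\mathcal P_t-\mathrm{id})$ be its generator. Assume that $\mathcal P$ has a faithful invariant state, i.e. there is a positive definite $\sigma\in\mathcal S(\mathcal H)$ with $\operatorname{Tr}[\sigma\mathcal P_t(X)]=\operatorname{Tr}[\sigma X]$ for all $t\ge0$ and $X\in\mathcal B(\mathcal H)$. Let $$\mathcal N(\mathcal P)=\{X:\ \mathcal P_t(X^*Y)=\mathcal P_t(X)^*\mathcal P_t(Y),\ \mathcal P_t(YX^*)=\mathcal P_t(Y)\mathcal P_t(X)^*\ \ \forall t\ge0,\ \forall Y\in\mathcal B(\mathcal H)\}$$ be the decoherence-free (DF) algebra, and let $E_{\mathcal N}$ be the unique completely positive projection of $\mathcal B(\mathcal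 H)$ with image $\mathcal N(\mathcal P)$ and kernel $\{X:\lim_{t\to\infty}\mathcal P_t(X)=0\}$, which moreover satisfies $\operatorname{Tr}[\sigma E_{\mathcal N}(X)]=\operatorname{Tr}[\sigma X]$ for every faithful invariant state $\sigma$. For a linear map $T$ on $\mathcal B(\mathcal H)$ let $T_*$ be its predual, $\operatorname{Tr}[T(X)Y]=\operatorname{Tr}[X\,T_*(Y)]$. Put $$\sigma_{\operatorname{Tr}}=E_{\mathcal N*}(I/d),\qquad \langle X,Y\rangle=\operatorname{Tr}[\sigma_{\operatorname{Tr}}^{1/2}X^*\sigma_{\operatorname{Tr}}^{1/2}Y],\qquad \|X\|_2^2=\langle X,X\rangle .$$ Assume that $\mathcal P$ is reversible: $\langle\mathcal P_t(X),Y\rangle=\langle X,\mathcal P_t(Y)\rangle$ for all $t\ge 0$ and $X,Y\in\mathcal B(\mathcal H)$. The DF spectral gap $\lambda(\mathcal L)$ is the best (largest) constant $\lambda$ such that $$\lambda\,\|X-E_{\mathcal N}(X)\|_2^2\le-\langle X,\mathcal L(X)\rangle\qquad\text{for all selfadjoint }X\in\mathcal B(\mathcal H).$$ With $D(\rho\|\rho')=\operatorname{Tr}[\rho(\log\rho-\log\rho')]$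 if $\operatorname{supp}\rho\subseteq\operatorname{supp}\rho'$ and $D(\rho\|\rho')=+\infty$ otherwise, $\rho_{\mathcal N}=E_{\mathcal N*}(\rho)$, and $$\operatorname{EP}_{\mathcal L}(\rho)=-\operatorname{Tr}[\mathcal L_*(\rho)(\log\rho-\log\sigma_{\operatorname{Tr}})]\in[0,+\infty]$$ (logarithms of states are taken on their support; for non-faithful $\rho$ the value is $+\infty$ if the compression of $\mathcal L_*(\rho)$ to $\ker\rho$ is nonzero), the DF modified log-Sobolev constant is the best constant $\alpha$ in $2\alpha D(\rho\|\rho_{\mathcal N})\le\operatorname{EP}_{\mathcal L}(\rho)$: $$\alpha_{\mathcal N}(\mathcal L)=\inf_{\rho\in\mathcal S(\mathcal H),\ D(\rho\|\rho_{\mathcal N})\ne0}\ \frac{\operatorname{EP}_{\mathcal L}(\rho)}{2\,D(\rho\|\rho_{\mathcal N})}.$$ (Both constants are $+\infty$ when $\mathcal N(\mathcal P)=\mathcal B(\mathcal H)$.) Then $$\alpha_{\mathcal N}(\mathcal L)\le\lambda(\mathcal L).$$ -/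

import Mathlib

open scoped NNReal Topology InnerProductSpace CStarAlgebra
open Filter

noncomputable section

namespace QMS

/-- Trace of an operator on a finite-dimensional Hilbert space. -/
def tr {H : Type*} [NormedAddCommGroup H] [InnerProductSpace ℂ H] (X : H →L[ℂ] H) : ℂ :=
  LinearMap.trace ℂ H (X : H →ₗ[ℂ] H)

/-- `ρ` is a density matrix: positive semidefinite with trace one. -/
def IsState {H : Type*} [NormedAddCommGroup H] [InnerProductSpace ℂ H] [CompleteSpace H]
    (ρ : H →L[ℂ] H) : Prop :=
  0 ≤ ρ ∧ tr ρ = 1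

/-- The predual `T_*` of a linear map `T` on operators, written in an orthonormal basis:
`⟨bᵢ, T_*(Y) bⱼ⟩ = Tr [T(|bⱼ⟩⟨bᵢ|) Y]`. It does not depend on the basis: see
`tr_map_mul` (which says that `Tr [T(X) Y] = Tr [X T_*(Y)]`) and `predual_unique`. -/
def predual {H : Type*} [NormedAddCommGroup H] [InnerProductSpace ℂ H] [FiniteDimensional ℂ H]
    (T : (H →L[ℂ] H) →ₗ[ℂ] (H →L[ℂ] H)) (Y : H →L[ℂ] H) : H →L[ℂ] H :=
  let b := stdOrthonormalBasis ℂ H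
  ∑ i, ∑ j, tr (T (InnerProductSpace.rankOne ℂ (b j) (b i)) * Y) •
    InnerProductSpace.rankOne ℂ (b i) (b j)

section TraceFacts

variable {H : Type*} [NormedAddCommGroup H] [InnerProductSpace ℂ H]

theorem tr_add (X Y : H →L[ℂ] H) : tr (X + Y) = tr X + tr Y := by
  simp [tr]

theorem tr_smul (c : ℂ) (X : H →L[ℂ] H) : tr (c • X) = c * tr X := by
  simp [tr]

theorem tr_sum {ι : Type*} (s : Finset ι) (X : ι → (H →L[ℂ] H)) :
    tr (∑ i ∈ s, X i) = ∑ i ∈ s, tr (X i) := by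
  classical
  induction s using Finset.induction_on with
  | empty => simp [tr]
  | insert a s ha ih => rw [Finset.sum_insert ha, Finset.sum_insert ha, tr_add, ih]

theorem tr_mul_rankOne [FiniteDimensional ℂ H] (X : H →L[ℂ] H) (x y : H) :
    tr (X * InnerProductSpace.rankOne ℂ x y) = ⟪y, X x⟫_ℂ := by
  have h : X * InnerProductSpace.rankOne ℂ x y = InnerProductSpace.rankOne ℂ (X x) y := by
    ext v; simp
  rw [h]
  exact InnerProductSpace.trace_rankOne _ _

theorem op_eq_sum [FiniteDimensional ℂ H] (X : H →L[ℂ] H) :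
    X = ∑ i, ∑ j, ⟪stdOrthonormalBasis ℂ H j, X (stdOrthonormalBasis ℂ H i)⟫_ℂ •
      InnerProductSpace.rankOne ℂ (stdOrthonormalBasis ℂ H j) (stdOrthonormalBasis ℂ H i) := by
  ext v
  conv_lhs => rw [← (stdOrthonormalBasis ℂ H).sum_repr' v]
  simp only [map_sum, map_smul, sum_apply, smul_apply,
    InnerProductSpace.rankOne_apply]
  refine Finset.sum_congr rfl fun i _ => ?_
  conv_lhs => rw [← (stdOrthonormalBasis ℂ H).sum_repr' (X (stdOrthonormalBasis ℂ H i))]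
  rw [Finset.smul_sum]
  exact Finset.sum_congr rfl fun j _ => smul_comm _ _ _

/-- The defining relation of the predual. -/
theorem tr_map_mul [FiniteDimensional ℂ H] (T : (H →L[ℂ] H) →ₗ[ℂ] (H →L[ℂ] H))
    (X Y : H →L[ℂ] H) : tr (T X * Y) = tr (X * predual T Y) := by
  conv_lhs => rw [op_eq_sum X]
  simp only [map_sum, map_smul, Finset.sum_mul, smul_mul_assoc, tr_sum, tr_smul, predual,
    Finset.mul_sum, mul_smul_comm, tr_mul_rankOne]
  exact Finset.sum_congr rfl fun i _ => Finset.sum_congr rfl fun j _ => mul_comm _ _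

/-- The defining relation determines the predual. -/
theorem predual_unique [FiniteDimensional ℂ H] (T : (H →L[ℂ] H) →ₗ[ℂ] (H →L[ℂ] H))
    (Y Z : H →L[ℂ] H) (h : ∀ X, tr (T X * Y) = tr (X * Z)) : Z = predual T Y := by
  have key : ∀ (A : H →L[ℂ] H) (x y : H), tr (InnerProductSpace.rankOne ℂ x y * A) = ⟪y, A x⟫_ℂ := by
    intro A x y
    rw [← tr_mul_rankOne]
    exact LinearMap.trace_mul_comm ℂ _ _
  ext v
  refine ext_inner_left ℂ fun w => ?_
  rw [← key, ← key, ← h, tr_map_mul]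

end TraceFacts

end QMS

/-- A quantum Markov semigroup on `B(H)` in the Heisenberg picture: a continuous one-parameter
semigroup of completely positive unital maps. -/
structure QMS (H : Type*) [NormedAddCommGroup H] [InnerProductSpace ℂ H] [CompleteSpace H] where
  map : ℝ≥0 → ((H →L[ℂ] H) →CP (H →L[ℂ] H))
  map_zero : ∀ X, map 0 X = X
  map_add : ∀ s t X, map (s + t) X = map s (map t X)
  map_one : ∀ t, map t 1 = 1
  continuous : ∀ X, Continuous fun t => map t X

namespace QMS

/-- `⟨X, Y⟩_σ = Tr [σ^{1/2} X* σ^{1/2} Y]`. -/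
def kms {H : Type*} [NormedAddCommGroup H] [InnerProductSpace ℂ H] [CompleteSpace H]
    (σ X Y : H →L[ℂ] H) : ℂ :=
  tr (CFC.sqrt σ * star X * CFC.sqrt σ * Y)

/-- The relative entropy `D(ρ‖σ) = Tr [ρ (log ρ - log σ)]` of two positive semidefinite operators,
with value `+∞` unless `supp ρ ⊆ supp σ`. Since `Real.log 0 = 0`, the operator `CFC.log` is the
logarithm on the support, extended by zero to the kernel. -/
def relEntropy {H : Type*} [NormedAddCommGroup H] [InnerProductSpace ℂ H] [CompleteSpace H]
    (ρ σ : H →L[ℂ] H) : EReal :=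
  open Classical in
  if ∀ v, σ v = 0 → ρ v = 0 then ((tr (ρ * (CFC.log ρ - CFC.log σ))).re : EReal) else ⊤

variable {H : Type*} [NormedAddCommGroup H] [InnerProductSpace ℂ H] [CompleteSpace H]

/-- The decoherence-free algebra `N(P)`. -/
def dfAlgebra (P : QMS H) : Set (H →L[ℂ] H) :=
  {X | ∀ t Y, P.map t (star X * Y) = star (P.map t X) * P.map t Y ∧
    P.map t (Y * star X) = P.map t Y * star (P.map t X)}

/-- `σ` is a faithful (i.e. positive definite) invariant state of `P`. -/
def IsFaithfulInvariant (P : QMS H) (σ : H →L[ℂ] H) : Prop :=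
  IsState σ ∧ IsStrictlyPositive σ ∧ ∀ t X, tr (σ * P.map t X) = tr (σ * X)

/-- `E` is a conditional expectation (completely positive projection) onto the decoherence-free
algebra, compatible with the faithful invariant states, whose kernel consists of the observables
that vanish in the long time. There is at most one such map, because the image and the
kernel of a projection determine it; there is one as soon as `P` has a faithful invariant state. -/
structure IsDFCondExp (P : QMS H) (E : (H →L[ℂ] H) →CP (H →L[ℂ] H)) : Prop where
  idem : ∀ X, E (E X) = E X
  range_eq : Set.range E = P.dfAlgebra
  compatible : ∀ σ, P.IsFaithfulInvariant σ → ∀ X, tr (σ * E X) = tr (σ * X)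
  ker_iff : ∀ X, E X = 0 ↔ Tendsto (fun t => P.map t X) atTop (𝓝 0)

/-- The conditional expectation `E_N` of `P` onto its decoherence-free algebra (a junk value is
used only for semigroups without such a map, hence without a faithful invariant state). -/
def dfCondExp (P : QMS H) : (H →L[ℂ] H) →ₗ[ℂ] (H →L[ℂ] H) :=
  open Classical in
  if h : ∃ E, P.IsDFCondExp E then h.choose.toLinearMap else 0

variable [FiniteDimensional ℂ H]

/-- The Lindbladian `L = lim_{t → 0+} (P_t - I) / t`. The limit is taken in norm and exists
because `P` is a continuous semigroup on a finite-dimensional space. -/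
def generator (P : QMS H) : (H →L[ℂ] H) →L[ℂ] (H →L[ℂ] H) :=
  limUnder (𝓝[>] (0 : ℝ≥0)) fun t =>
    ((t : ℝ) : ℂ)⁻¹ • (LinearMap.toContinuousLinearMap (P.map t).toLinearMap -
      ContinuousLinearMap.id ℂ (H →L[ℂ] H))

/-- The predual `L_*` of the Lindbladian. -/
def preGenerator (P : QMS H) (ρ : H →L[ℂ] H) : H →L[ℂ] H :=
  predual (P.generator : (H →L[ℂ] H) →ₗ[ℂ] (H →L[ℂ] H)) ρ

/-- The predual `E_{N*}` of the conditional expectation; `E_{N*}(ρ)` is the state `ρ_N`. -/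
def dfState (P : QMS H) (ρ : H →L[ℂ] H) : H →L[ℂ] H :=
  predual P.dfCondExp ρ

/-- The reference state `σ_Tr = E_{N*}(I / d)`, where `d = dim H`. -/
def sigmaTr (P : QMS H) : H →L[ℂ] H :=
  P.dfState ((Module.finrank ℂ H : ℂ)⁻¹ • 1)

/-- `P` has a faithful invariant state and is selfadjoint for `⟨·, ·⟩_{σ_Tr}`. -/
def IsReversible (P : QMS H) : Prop :=
  (∃ σ, P.IsFaithfulInvariant σ) ∧
    ∀ t X Y, kms P.sigmaTr (P.map t X) Y = kms P.sigmaTr X (P.map t Y)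

/-- The decoherence-free variance `Var_N(X) = ‖X - E_N(X)‖²` for the norm of
`⟨·, ·⟩_{σ_Tr}`. -/
def dfVariance (P : QMS H) (X : H →L[ℂ] H) : ℝ :=
  (kms P.sigmaTr (X - P.dfCondExp X) (X - P.dfCondExp X)).re

/-- The Dirichlet form `E_L(X) = -⟨X, L(X)⟩_{σ_Tr}` (a real number for selfadjoint `X`). -/
def dirichlet (P : QMS H) (X : H →L[ℂ] H) : ℝ :=
  -(kms P.sigmaTr X (P.generator X)).re

/-- The decoherence-free Poincaré inequality with constant `c`. -/
def PoincareIneq (P : QMS H) (c : ℝ) : Prop :=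
  ∀ X : H →L[ℂ] H, IsSelfAdjoint X → c * P.dfVariance X ≤ P.dirichlet X

/-- The decoherence-free spectral gap `λ(L)`: the best constant in the decoherence-free Poincaré
inequality. It is `+∞` when the variance vanishes identically, i.e. `N(P) = B(H)`. -/
def spectralGap (P : QMS H) : EReal :=
  ⨆ (c : ℝ) (_ : P.PoincareIneq c), (c : EReal)

/-- The decoherence-free relative entropy `D_N(ρ) = D(ρ‖ρ_N)`. -/
def dfRelEntropy (P : QMS H) (ρ : H →L[ℂ] H) : EReal :=
  relEntropy ρ (P.dfState ρ)

/-- The entropy production `EP_L(ρ) = -Tr [L_*(ρ) (log ρ - log σ_Tr)]`. For a state `ρ` with a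
kernel, `L_*(ρ)` is positive semidefinite on `ker ρ`; if its compression to `ker ρ` is not zero,
then `-Tr [L_*(ρ) log ρ] = +∞`. -/
def entropyProduction (P : QMS H) (ρ : H →L[ℂ] H) : EReal :=
  open Classical in
  if ∀ v, ρ v = 0 → ⟪v, P.preGenerator ρ v⟫_ℂ = 0 then
    ((-(tr (P.preGenerator ρ * (CFC.log ρ - CFC.log P.sigmaTr))).re : ℝ) : EReal)
  else ⊤

/-- The decoherence-free modified log-Sobolev constant
`α_N(L) = inf_ρ EP_L(ρ) / (2 D_N(ρ))`: the best constant in `2 α D_N(ρ) ≤ EP_L(ρ)`. States with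
`D_N(ρ) = 0`, where the quotient is not defined, put no constraint on the constant. -/
def logSobolevConst (P : QMS H) : EReal :=
  ⨅ (ρ : H →L[ℂ] H) (_ : IsState ρ) (_ : P.dfRelEntropy ρ ≠ 0),
    P.entropyProduction ρ / (2 * P.dfRelEntropy ρ)

end QMS

end

/-!
The idea is to test the modified log-Sobolev inequality on states close to `σ = σ_Tr` in the
direction of an eigenvector of the generator `L` that realizes the spectral gap.

*Spectral side.* Reversibility makes `L` symmetric for the KMS inner product, which is definite
because `σ` is a faithful state (`sigmaTr_faithful`), so `L` has a KMS-orthonormal eigenbasis with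
real eigenvalues. The semigroup acts on it by exponentials and is contractive, so the eigenvalues
are nonpositive. An eigenvector with a negative eigenvalue vanishes in the long time. An element of
the decoherence-free algebra is orthogonal to those in the GNS form of any faithful invariant
state, and this forces the semigroup to fix it. Hence `E_N` is the spectral projection at the
eigenvalue zero (`exists_generator_eigenbasis`), and the Poincaré inequality holds with the smallest
nonzero eigenvalue `μ` of `-L`. That `E_N` exists at all is proved in `exists_isDFCondExp`: an
idempotent limit point of the semigroup at infinity is such a map, by the Kadison–Schwarz
inequality.

*Entropic side.* Let `X` be a selfadjoint eigenvector, `L X = -μ X`, let `Y = σ^{1/2} X σ^{1/2}` and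
`ρ_ε = σ + ε Y`. Then `L_* ρ_ε = -μ ε Y` and `E_{N*} ρ_ε = σ`. With `f(ε) = D(ρ_ε‖σ)` and
`g(ε) = Tr [Y (log ρ_ε - log σ)]` this says `EP(ρ_ε) = μ ε g(ε)` and `D_N(ρ_ε) = f(ε)`. No
derivative of the operator logarithm is needed: the identity
`f(a) - f(b) - (a - b) g(b) = D(ρ_a‖ρ_b) ≥ 0` says that `g` is a subgradient of `f`, and Klein's
inequality with a quadratic remainder (`quarter_tr_sq_le_relEntropy`) gives `f(ε) ≥ δ ε²`. If
`ε g(ε) ≥ 2 κ f(ε)` held near zero for some `κ > 1`, the function `f` would decay faster than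
`ε²` (`exists_mul_subgradient_lt`). So the quotient `EP(ρ_ε) / (2 D_N(ρ_ε))` takes values below
every number larger than `μ`, which is `logSobolevConst_le_of_eigenvector`.
-/

noncomputable section

set_option linter.unusedSectionVars false

namespace QMS

variable {H : Type*} [NormedAddCommGroup H] [InnerProductSpace ℂ H] [FiniteDimensional ℂ H]
  [CompleteSpace H]

/-! ### The trace -/

theorem tr_mul_comm (X Y : H →L[ℂ] H) : tr (X * Y) = tr (Y * X) :=
  LinearMap.trace_mul_comm ℂ _ _

theorem tr_sub (X Y : H →L[ℂ] H) : tr (X - Y) = tr X - tr Y := by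
  simp [tr]

theorem tr_eq_sum_inner {ι : Type*} [Fintype ι] (b : OrthonormalBasis ι ℂ H) (X : H →L[ℂ] H) :
    tr X = ∑ i, ⟪b i, X (b i)⟫_ℂ :=
  LinearMap.trace_eq_sum_inner _ b

theorem tr_star (X : H →L[ℂ] H) : tr (star X) = star (tr X) := by
  rw [tr_eq_sum_inner (stdOrthonormalBasis ℂ H), tr_eq_sum_inner (stdOrthonormalBasis ℂ H),
    star_sum]
  refine Finset.sum_congr rfl fun i _ => ?_
  rw [ContinuousLinearMap.star_eq_adjoint, ContinuousLinearMap.adjoint_inner_right]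
  exact (inner_conj_symm _ _).symm

theorem tr_star_mul_self (X : H →L[ℂ] H) :
    tr (star X * X) = ((∑ i, ‖X (stdOrthonormalBasis ℂ H i)‖ ^ 2 : ℝ) : ℂ) := by
  rw [tr_eq_sum_inner (stdOrthonormalBasis ℂ H)]
  push_cast
  refine Finset.sum_congr rfl fun i _ => ?_
  change ⟪_, star X (X _)⟫_ℂ = _
  rw [ContinuousLinearMap.star_eq_adjoint, ContinuousLinearMap.adjoint_inner_right,
    inner_self_eq_norm_sq_to_K]
  rfl

theorem tr_star_mul_self_nonneg (X : H →L[ℂ] H) : 0 ≤ (tr (star X * X)).re := by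
  rw [tr_star_mul_self, Complex.ofReal_re]
  positivity

theorem eq_zero_of_tr_star_mul_self {X : H →L[ℂ] H} (h : (tr (star X * X)).re = 0) : X = 0 := by
  rw [tr_star_mul_self, Complex.ofReal_re,
    Finset.sum_eq_zero_iff_of_nonneg fun i _ => by positivity] at h
  refine ContinuousLinearMap.coe_injective ((stdOrthonormalBasis ℂ H).toBasis.ext fun i => ?_)
  simpa using h i (Finset.mem_univ i)

theorem tr_sqrt_sandwich {σ : H →L[ℂ] H} (hσ : 0 ≤ σ) (B : H →L[ℂ] H) :
    tr (σ * (star B * B)) = tr (star (B * CFC.sqrt σ) * (B * CFC.sqrt σ)) := by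
  have hs : star (CFC.sqrt σ) = CFC.sqrt σ := (CFC.sqrt_nonneg σ).isSelfAdjoint
  conv_lhs => rw [← CFC.sqrt_mul_sqrt_self σ hσ]
  rw [star_mul, hs, mul_assoc, tr_mul_comm]
  simp only [mul_assoc]

theorem tr_mul_nonneg {σ M : H →L[ℂ] H} (hσ : 0 ≤ σ) (hM : 0 ≤ M) : 0 ≤ (tr (σ * M)).re := by
  obtain ⟨B, rfl⟩ := CStarAlgebra.nonneg_iff_eq_star_mul_self.mp hM
  rw [tr_sqrt_sandwich hσ]
  exact tr_star_mul_self_nonneg _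

theorem eq_zero_of_tr_mul {σ M : H →L[ℂ] H} (hσ : IsStrictlyPositive σ) (hM : 0 ≤ M)
    (h : (tr (σ * M)).re = 0) : M = 0 := by
  obtain ⟨B, rfl⟩ := CStarAlgebra.nonneg_iff_eq_star_mul_self.mp hM
  rw [tr_sqrt_sandwich hσ.nonneg] at h
  have hB := eq_zero_of_tr_star_mul_self h
  have : B = 0 := (IsStrictlyPositive.isUnit_cfcSqrt σ hσ).mul_left_eq_zero.mp hB
  simp [this]

theorem tr_nonneg {X : H →L[ℂ] H} (hX : 0 ≤ X) : 0 ≤ (tr X).re := by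
  simpa using tr_mul_nonneg zero_le_one hX

theorem tr_im_eq_zero {X : H →L[ℂ] H} (hX : IsSelfAdjoint X) : (tr X).im = 0 := by
  have := tr_star X
  rw [hX.star_eq] at this
  exact Complex.conj_eq_iff_im.mp this.symm

theorem continuous_tr : Continuous (tr : (H →L[ℂ] H) → ℂ) := by
  let f : (H →L[ℂ] H) →ₗ[ℂ] ℂ :=
    { toFun := tr, map_add' := tr_add, map_smul' := fun c X => by simp [tr_smul] }
  exact f.continuous_of_finiteDimensional

/-! ### The KMS inner product and its spectral theorem -/

/-- The KMS form is the Hilbert–Schmidt form of the operators `σ^{1/4} X σ^{1/4}`. -/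
theorem kms_eq_tr_star_mul {σ : H →L[ℂ] H} (X Y : H →L[ℂ] H) :
    kms σ X Y = tr (star (CFC.sqrt (CFC.sqrt σ) * X * CFC.sqrt (CFC.sqrt σ)) *
      (CFC.sqrt (CFC.sqrt σ) * Y * CFC.sqrt (CFC.sqrt σ))) := by
  have hr : star (CFC.sqrt (CFC.sqrt σ)) = CFC.sqrt (CFC.sqrt σ) :=
    (CFC.sqrt_nonneg (CFC.sqrt σ)).isSelfAdjoint
  have hrr : CFC.sqrt (CFC.sqrt σ) * CFC.sqrt (CFC.sqrt σ) = CFC.sqrt σ :=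
    CFC.sqrt_mul_sqrt_self _ (CFC.sqrt_nonneg σ)
  rw [kms]
  generalize CFC.sqrt (CFC.sqrt σ) = r at *
  rw [← hrr, star_mul, star_mul, hr]
  calc tr (r * r * star X * (r * r) * Y) = tr (r * (r * star X * r * r * Y)) := by
        simp only [mul_assoc]
    _ = tr (r * star X * r * r * Y * r) := tr_mul_comm _ _
    _ = _ := by simp only [mul_assoc]

theorem kms_add_right (σ X Y Z : H →L[ℂ] H) : kms σ X (Y + Z) = kms σ X Y + kms σ X Z := by
  simp only [kms, mul_add, tr_add]

theorem kms_smul_right (σ X Y : H →L[ℂ] H) (c : ℂ) : kms σ X (c • Y) = c * kms σ X Y := by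
  simp only [kms, mul_smul_comm, tr_smul]

theorem star_kms (σ X Y : H →L[ℂ] H) : star (kms σ X Y) = kms σ Y X := by
  rw [kms_eq_tr_star_mul, kms_eq_tr_star_mul, ← tr_star, star_mul, star_star]

theorem kms_self_nonneg (σ X : H →L[ℂ] H) : 0 ≤ (kms σ X X).re := by
  rw [kms_eq_tr_star_mul]
  exact tr_star_mul_self_nonneg _

theorem eq_zero_of_kms_self {σ X : H →L[ℂ] H} (hσ : IsStrictlyPositive σ)
    (h : (kms σ X X).re = 0) : X = 0 := by
  rw [kms_eq_tr_star_mul] at h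
  have hu : IsUnit (CFC.sqrt (CFC.sqrt σ)) :=
    IsStrictlyPositive.isUnit_cfcSqrt _ (IsStrictlyPositive.sqrt σ hσ)
  exact hu.mul_right_eq_zero.mp (hu.mul_left_eq_zero.mp (eq_zero_of_tr_star_mul_self h))

/-- For positive definite `σ` the KMS form is an inner product on the operators. -/
@[reducible]
def kmsCore {σ : H →L[ℂ] H} (hσ : IsStrictlyPositive σ) :
    InnerProductSpace.Core ℂ (H →L[ℂ] H) where
  inner X Y := kms σ X Y
  conj_inner_symm X Y := star_kms σ Y X
  re_inner_nonneg X := kms_self_nonneg σ X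
  add_left X Y Z := by simp only [kms, star_add, mul_add, add_mul, tr_add]
  smul_left X Y c := by
    simp only [kms, star_smul, mul_smul_comm, smul_mul_assoc, tr_smul]; rfl
  definite X h := eq_zero_of_kms_self hσ (by simp [h])

/-- The spectral theorem for an operator that is symmetric with respect to an inner product given
as a `Core`, which leaves the norm that the space may carry alone. -/
theorem exists_orthonormal_eigenvectors {V : Type*} [AddCommGroup V] [Module ℂ V]
    [FiniteDimensional ℂ V] (c : InnerProductSpace.Core ℂ V) (T : V →ₗ[ℂ] V)
    (hT : ∀ x y, c.inner (T x) y = c.inner x (T y)) :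
    ∃ (n : ℕ) (b : Fin n → V) (κ : Fin n → ℝ), (∀ i, T (b i) = (κ i : ℂ) • b i) ∧
      (∀ i j, c.inner (b i) (b j) = if i = j then 1 else 0) ∧
      (∀ x, ∑ i, c.inner (b i) x • b i = x) ∧
      ∀ x y, c.inner x y = ∑ i, star (c.inner (b i) x) * c.inner (b i) y := by
  let _ : NormedAddCommGroup V := c.toNormedAddCommGroup
  let _ : InnerProductSpace ℂ V := InnerProductSpace.ofCore c.toCore
  have hs : T.IsSymmetric := hT
  let b := hs.eigenvectorBasis rfl
  refine ⟨_, b, hs.eigenvalues rfl, fun i => hs.apply_eigenvectorBasis rfl i,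
    fun i j => orthonormal_iff_ite.mp b.orthonormal i j, fun x => b.sum_repr' x, fun x y => ?_⟩
  refine (b.sum_inner_mul_inner x y).symm.trans (Finset.sum_congr rfl fun i _ => ?_)
  congr 1
  exact (inner_conj_symm x (b i)).symm

/-! ### Differentiability of the semigroup -/

/-- A continuous one-parameter semigroup in a Banach algebra has a right derivative at zero: for
small `s` the integral `S` of `F` over `[0, s]` is invertible, and `F t * S` is an integral
over `[t, t + s]`, hence differentiable in `t`. -/
theorem exists_hasDerivWithinAt_of_semigroup {A : Type*} [NormedRing A] [NormedAlgebra ℝ A]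
    [CompleteSpace A] {F : ℝ → A} (hF : Continuous F) (h0 : F 0 = 1)
    (hadd : ∀ r u, 0 ≤ r → 0 ≤ u → F (r + u) = F r * F u) :
    ∃ L, HasDerivWithinAt F L (Set.Ici 0) 0 := by
  have hI : ∀ x, HasDerivAt (fun y => ∫ u in (0 : ℝ)..y, F u) (F x) x := fun x =>
    (hF.integral_hasStrictDerivAt 0 x).hasDerivAt
  obtain ⟨s, hs0, hs⟩ : ∃ s : ℝ, 0 < s ∧ IsUnit (∫ u in (0 : ℝ)..s, F u) := by
    have h1 : Tendsto (fun t : ℝ => t⁻¹ • ∫ u in (0 : ℝ)..t, F u) (𝓝[>] 0) (𝓝 1) := by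
      have hsub : Set.Ioi (0 : ℝ) ⊆ {0}ᶜ := fun x hx => ne_of_gt hx
      have := ((hI 0).tendsto_slope_zero).mono_left (nhdsWithin_mono (0 : ℝ) hsub)
      simpa [h0] using this
    obtain ⟨s, hs, hs0⟩ := ((h1.eventually (Units.isOpen.mem_nhds isUnit_one)).and
      self_mem_nhdsWithin).exists
    refine ⟨s, hs0, ?_⟩
    have h2 : IsUnit (algebraMap ℝ A s * (s⁻¹ • ∫ u in (0 : ℝ)..s, F u)) :=
      ((IsUnit.mk0 s (ne_of_gt hs0)).map (algebraMap ℝ A)).mul hs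
    rwa [← Algebra.smul_def, smul_inv_smul₀ (ne_of_gt hs0)] at h2
  obtain ⟨S, hS⟩ := hs
  have hFt : ∀ t ∈ Set.Ici (0 : ℝ),
      F t = ((∫ u in (0 : ℝ)..(t + s), F u) - ∫ u in (0 : ℝ)..t, F u) * (S⁻¹ : Aˣ) := by
    intro t ht
    rw [Units.eq_mul_inv_iff_mul_eq, hS, intervalIntegral.integral_interval_sub_left
      (hF.intervalIntegrable _ _) (hF.intervalIntegrable _ _)]
    have : ∫ u in (0 : ℝ)..s, F t * F u = F t * ∫ u in (0 : ℝ)..s, F u :=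
      (ContinuousLinearMap.mul ℝ A (F t)).intervalIntegral_comp_comm (hF.intervalIntegrable _ _)
    have h2 := intervalIntegral.integral_comp_add_left (a := 0) (b := s) F t
    rw [add_zero] at h2
    rw [← this, ← h2]
    refine intervalIntegral.integral_congr fun u hu => ?_
    rw [Set.uIcc_of_le hs0.le] at hu
    exact (hadd t u ht hu.1).symm
  have h3 := (((hI (0 + s)).comp_add_const 0 s).sub (hI 0)).hasDerivWithinAt
    (s := Set.Ici 0) |>.mul_const (S⁻¹ : Aˣ).val
  exact ⟨_, h3.congr hFt (hFt 0 Set.self_mem_Ici)⟩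

/-- The maps of the semigroup as bounded operators on `B(H)`. -/
def op (P : QMS H) (t : ℝ≥0) : (H →L[ℂ] H) →L[ℂ] (H →L[ℂ] H) :=
  LinearMap.toContinuousLinearMap (P.map t).toLinearMap

theorem op_apply (P : QMS H) (t : ℝ≥0) (X : H →L[ℂ] H) : P.op t X = P.map t X := rfl

theorem op_zero (P : QMS H) : P.op 0 = 1 := by
  ext1 X
  exact P.map_zero X

theorem op_add (P : QMS H) (s t : ℝ≥0) : P.op (s + t) = P.op s * P.op t := by
  ext1 X
  exact P.map_add s t X

theorem continuous_op (P : QMS H) : Continuous P.op :=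
  continuous_clm_apply.mpr P.continuous

theorem tendsto_generator (P : QMS H) :
    Tendsto (fun t : ℝ≥0 => ((t : ℝ) : ℂ)⁻¹ • (P.op t - 1)) (𝓝[>] 0) (𝓝 P.generator) := by
  obtain ⟨L, hL⟩ := exists_hasDerivWithinAt_of_semigroup
    (P.continuous_op.comp continuous_real_toNNReal) (by simp [op_zero]) fun r u hr hu => by
      simp only [Function.comp_apply, Real.toNNReal_add hr hu, op_add]
  refine tendsto_nhds_limUnder ⟨L, ?_⟩
  have h1 := hL.mono Set.Ioi_subset_Ici_self
  rw [hasDerivWithinAt_iff_tendsto_slope' (by simp)] at h1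
  have h2 : Tendsto (fun t : ℝ≥0 => (t : ℝ)) (𝓝[>] 0) (𝓝[>] 0) :=
    tendsto_nhdsWithin_iff.mpr ⟨(NNReal.continuous_coe.tendsto' 0 0 rfl).mono_left
      nhdsWithin_le_nhds, ?_⟩
  · refine (h1.comp h2).congr fun t => ?_
    simp only [Function.comp_apply, slope_def_module, sub_zero, Real.toNNReal_coe,
      Real.toNNReal_zero, op_zero]
    rw [← Complex.ofReal_inv]
    exact (Complex.coe_smul _ _).symm
  · filter_upwards [self_mem_nhdsWithin] with t ht
    exact NNReal.coe_pos.mpr ht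

theorem tendsto_generator_apply (P : QMS H) (X : H →L[ℂ] H) :
    Tendsto (fun t : ℝ≥0 => ((t : ℝ) : ℂ)⁻¹ • (P.map t X - X)) (𝓝[>] 0) (𝓝 (P.generator X)) :=
  ((ContinuousLinearMap.apply ℂ (H →L[ℂ] H) X).continuous.tendsto _).comp P.tendsto_generator

theorem map_star (P : QMS H) (t : ℝ≥0) (X : H →L[ℂ] H) : P.map t (star X) = star (P.map t X) :=
  StarHomClass.map_star (P.map t) X

theorem generator_one (P : QMS H) : P.generator 1 = 0 := by
  refine tendsto_nhds_unique (P.tendsto_generator_apply 1) ?_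
  simp [P.map_one]

theorem generator_star (P : QMS H) (X : H →L[ℂ] H) :
    P.generator (star X) = star (P.generator X) := by
  refine tendsto_nhds_unique (P.tendsto_generator_apply (star X)) ?_
  refine ((continuous_star.tendsto _).comp (P.tendsto_generator_apply X)).congr fun t => ?_
  simp [map_star]

theorem continuous_kms_right (σ X : H →L[ℂ] H) : Continuous fun Y => kms σ X Y :=
  continuous_tr.comp (by fun_prop)

theorem continuous_kms_left (σ Y : H →L[ℂ] H) : Continuous fun X => kms σ X Y :=
  continuous_tr.comp (by fun_prop)

theorem generator_kms (P : QMS H) {σ : H →L[ℂ] H}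
    (h : ∀ t X Y, kms σ (P.map t X) Y = kms σ X (P.map t Y)) (X Y : H →L[ℂ] H) :
    kms σ (P.generator X) Y = kms σ X (P.generator Y) := by
  refine tendsto_nhds_unique
    (((continuous_kms_left σ Y).tendsto _).comp (P.tendsto_generator_apply X)) ?_
  refine (((continuous_kms_right σ X).tendsto _).comp
    (P.tendsto_generator_apply Y)).congr fun t => ?_
  have := h t X Y
  simp only [kms, Function.comp_apply, star_smul, star_sub, mul_sub, sub_mul, mul_smul_comm,
    smul_mul_assoc, tr_smul] at this ⊢
  have e : star (((t : ℝ) : ℂ)⁻¹) = ((t : ℝ) : ℂ)⁻¹ := by simp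
  rw [e, sub_eq_add_neg, sub_eq_add_neg, tr_add, tr_add, this]

theorem hasDerivWithinAt_map (P : QMS H) (X : H →L[ℂ] H) (t : ℝ) (ht : 0 ≤ t) :
    HasDerivWithinAt (fun r : ℝ => P.map r.toNNReal X) (P.map t.toNNReal (P.generator X))
      (Set.Ici t) t := by
  rw [← hasDerivWithinAt_Ioi_iff_Ici, hasDerivWithinAt_iff_tendsto_slope' (by simp)]
  have h1 : Tendsto (fun r : ℝ => (r - t).toNNReal) (𝓝[>] t) (𝓝[>] 0) := by
    refine tendsto_nhdsWithin_iff.mpr ⟨?_, ?_⟩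
    · refine Tendsto.mono_left ?_ nhdsWithin_le_nhds
      exact Continuous.tendsto' (by fun_prop) _ _ (by simp)
    · filter_upwards [self_mem_nhdsWithin] with r hr
      simpa using hr
  have h2 := ((P.op t.toNNReal).continuous.tendsto _).comp ((P.tendsto_generator_apply X).comp h1)
  refine h2.congr' ?_
  filter_upwards [self_mem_nhdsWithin] with r hr
  have hr' : 0 ≤ r - t := sub_nonneg.mpr (le_of_lt hr)
  have e : r.toNNReal = t.toNNReal + (r - t).toNNReal := by
    rw [← Real.toNNReal_add ht hr', add_sub_cancel]
  rw [slope_def_module, e, P.map_add]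
  simp only [Function.comp_apply, map_smul, map_sub, op_apply, Real.coe_toNNReal _ hr']
  rw [← Complex.ofReal_inv, Complex.coe_smul]

/-- On an eigenvector of the generator the semigroup acts by an exponential. -/
theorem map_of_generator_eq_smul (P : QMS H) {X : H →L[ℂ] H} {κ : ℝ}
    (h : P.generator X = (κ : ℂ) • X) (t : ℝ≥0) : P.map t X = Real.exp (κ * t) • X := by
  have hc : ∀ r : ℝ, 0 ≤ r → HasDerivWithinAt
      (fun r : ℝ => Real.exp (-κ * r) • P.map r.toNNReal X) 0 (Set.Ici r) r := by
    intro r hr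
    have h1 : HasDerivAt (fun r : ℝ => Real.exp (-κ * r)) (Real.exp (-κ * r) * (-κ)) r := by
      simpa using ((hasDerivAt_id r).const_mul (-κ)).exp
    have h2 := h1.hasDerivWithinAt.smul (P.hasDerivWithinAt_map X r hr)
    rw [h, map_smul, Complex.coe_smul, smul_smul, ← add_smul, mul_neg, add_neg_cancel,
      zero_smul] at h2
    exact h2
  have h3 := constant_of_has_deriv_right_zero (a := 0) (b := t)
    (f := fun r : ℝ => Real.exp (-κ * r) • P.map r.toNNReal X)
    (Continuous.continuousOn (by
      have := P.continuous X
      fun_prop)) (fun r hr => hc r hr.1) t ⟨t.2, le_rfl⟩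
  simp only [Real.toNNReal_coe, mul_zero, Real.exp_zero, Real.toNNReal_zero, P.map_zero,
    one_smul] at h3
  conv_rhs => rw [← h3, smul_smul, ← Real.exp_add, neg_mul, add_neg_cancel, Real.exp_zero, one_smul]

/-! ### Kadison–Schwarz inequality and multiplicative domain -/

/-- The Kadison–Schwarz inequality. -/
theorem star_mul_self_le_map (Φ : (H →L[ℂ] H) →CP (H →L[ℂ] H)) (h1 : Φ 1 = 1) (X : H →L[ℂ] H) :
    star (Φ X) * Φ X ≤ Φ (star X * X) := by
  -- `Φ` maps the positive matrix `((X* X, X*), (X, 1))` to a positive matrix, which is then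
  -- tested on the column `(1, -Φ X)`.
  let B : CStarMatrix (Fin 2) (Fin 2) (H →L[ℂ] H) := CStarMatrix.ofMatrix !![X, 1; 0, 0]
  let C : CStarMatrix (Fin 2) (Fin 2) (H →L[ℂ] H) := CStarMatrix.ofMatrix !![1, 0; -Φ X, 0]
  have h2 : 0 ≤ (star B * B).map Φ := Φ.map_cstarMatrix_nonneg _ (star_mul_self_nonneg B)
  have h3 : 0 ≤ star C * (star B * B).map Φ * C := star_left_conjugate_nonneg h2 C
  have h4 : 0 ≤ (star C * (star B * B).map Φ * C) 0 0 := by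
    refine AddSubmonoid.closure_induction (motive := fun M _ => 0 ≤ M 0 0) ?_ le_rfl
      (fun M N _ _ hM hN => add_nonneg hM hN) (StarOrderedRing.nonneg_iff.mp h3)
    rintro _ ⟨D, rfl⟩
    change 0 ≤ (star D * D) 0 0
    rw [CStarMatrix.mul_apply]
    refine Finset.sum_nonneg fun i _ => ?_
    rw [CStarMatrix.star_apply]
    exact star_mul_self_nonneg _
  have h5 : (star C * (star B * B).map Φ * C) 0 0 = Φ (star X * X) - star (Φ X) * Φ X := by
    simp [CStarMatrix.mul_apply, CStarMatrix.star_apply, CStarMatrix.map_apply, B, C, h1,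
      StarHomClass.map_star, sub_eq_add_neg]
  rw [h5] at h4
  exact sub_nonneg.mp h4

/-- If the Kadison–Schwarz inequality is an equality at `X`, then `X` belongs to the (left)
multiplicative domain. -/
theorem map_star_mul_of_eq (Φ : (H →L[ℂ] H) →CP (H →L[ℂ] H)) (h1 : Φ 1 = 1) {X : H →L[ℂ] H}
    (hX : Φ (star X * X) = star (Φ X) * Φ X) (Y : H →L[ℂ] H) :
    Φ (star X * Y) = star (Φ X) * Φ Y := by
  have hs : ∀ Z, Φ (star Z) = star (Φ Z) := fun Z => StarHomClass.map_star Φ Z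
  rw [← sub_eq_zero]
  set A := Φ (star X * Y) - star (Φ X) * Φ Y with hA
  set B := Φ (star Y * Y) - star (Φ Y) * Φ Y with hB
  have hAs : star A = Φ (star Y * X) - star (Φ Y) * Φ X := by
    rw [hA, star_sub, star_mul, star_star, ← hs, star_mul, star_star]
  have hpos : ∀ s : ℂ, 0 ≤ star s • A + s • star A + B := by
    intro s
    have h2 := sub_nonneg.mpr (star_mul_self_le_map Φ h1 (s • X + Y))
    convert h2 using 1
    rw [hAs, hA, hB]
    simp only [star_add, star_smul, add_mul, mul_add, smul_mul_assoc, mul_smul_comm, _root_.map_add,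
      _root_.map_smul, hX, smul_sub, smul_add]
    abel
  have hz : ∀ v, ⟪A v, v⟫_ℂ = 0 := by
    intro v
    by_contra hne
    set z := ⟪A v, v⟫_ℂ with hzdef
    have hn : 0 < ‖z‖ ^ 2 := by positivity
    obtain ⟨n, hn'⟩ := exists_nat_gt ((⟪B v, v⟫_ℂ).re / (2 * ‖z‖ ^ 2))
    rw [div_lt_iff₀ (by positivity)] at hn'
    have h3 := ((ContinuousLinearMap.nonneg_iff_isPositive _).mp
      (hpos (-(n : ℂ) * star z))).re_inner_nonneg_left v
    have h4 : ⟪(star (-(n : ℂ) * star z) • A + (-(n : ℂ) * star z) • star A + B) v, v⟫_ℂ =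
        -(2 * n * ‖z‖ ^ 2 : ℝ) + ⟪B v, v⟫_ℂ := by
      have h5 : ⟪star A v, v⟫_ℂ = star z := by
        rw [ContinuousLinearMap.star_eq_adjoint, ContinuousLinearMap.adjoint_inner_left, hzdef]
        exact (inner_conj_symm _ _).symm
      have h6 : star z * z = ((‖z‖ ^ 2 : ℝ) : ℂ) := by
        rw [mul_comm]
        have := Complex.mul_conj z
        rwa [Complex.normSq_eq_norm_sq] at this
      change ⟪star (-(n : ℂ) * star z) • A v + (-(n : ℂ) * star z) • (star A) v + B v, v⟫_ℂ = _
      rw [inner_add_left, inner_add_left, inner_smul_left, inner_smul_left, h5, ← hzdef]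
      simp only [starRingEnd_apply, star_mul', star_neg, star_star, star_natCast]
      push_cast at h6 ⊢
      linear_combination (-2 * (n : ℂ)) * h6
    rw [h4] at h3
    simp only [RCLike.re_to_complex, Complex.add_re, Complex.neg_re, Complex.ofReal_re] at h3
    linarith
  exact ContinuousLinearMap.coe_injective (inner_map_self_eq_zero (A : H →ₗ[ℂ] H) |>.mp hz)

/-! ### Existence of the conditional expectation -/

theorem norm_map_le (P : QMS H) (t : ℝ≥0) (X : H →L[ℂ] H) : ‖P.map t X‖ ≤ ‖X‖ := by
  have h0 : ‖P.map t (star X * X)‖ ≤ ‖star X * X‖ := by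
    have h := PositiveLinearMap.norm_apply_le_of_nonneg
      (PositiveLinearMap.mk₀ (P.map t).toLinearMap fun Y hY => map_nonneg (P.map t) hY)
      (star X * X) (star_mul_self_nonneg X)
    refine h.trans ?_
    have h1 : ‖P.map t 1‖ ≤ 1 := by
      rw [P.map_one]
      exact ContinuousLinearMap.norm_id_le
    exact mul_le_of_le_one_left (norm_nonneg _) h1
  have h1 := CStarAlgebra.norm_le_norm_of_nonneg_of_le (star_mul_self_nonneg _)
    (star_mul_self_le_map (P.map t) (P.map_one t) X)
  rw [CStarRing.norm_star_mul_self] at h1 h0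
  nlinarith [norm_nonneg (P.map t X), norm_nonneg X]

/-- Along some ultrafilter at infinity the semigroup converges to an idempotent: the limit points
at infinity form a compact semigroup. -/
theorem exists_idempotent_limit (P : QMS H) :
    ∃ (m : (H →L[ℂ] H) →L[ℂ] (H →L[ℂ] H)) (U : Ultrafilter ℝ≥0), (U : Filter ℝ≥0) ≤ atTop ∧
      Tendsto P.op U (𝓝 m) ∧ m * m = m := by
  have : ProperSpace ((H →L[ℂ] H) →L[ℂ] (H →L[ℂ] H)) := FiniteDimensional.proper ℂ _
  have hball : ∀ t, P.op t ∈ Metric.closedBall (0 : (H →L[ℂ] H) →L[ℂ] (H →L[ℂ] H)) 1 := fun t => by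
    rw [mem_closedBall_zero_iff]
    exact ContinuousLinearMap.opNorm_le_bound _ zero_le_one fun X => by
      simpa [op_apply] using P.norm_map_le t X
  have hcomp := isCompact_closedBall (0 : (H →L[ℂ] H) →L[ℂ] (H →L[ℂ] H)) 1
  let S : Set ((H →L[ℂ] H) →L[ℂ] (H →L[ℂ] H)) := {T | MapClusterPt T atTop P.op}
  have hSsub : S ⊆ Metric.closedBall 0 1 := fun T hT =>
    Metric.isClosed_closedBall.mem_of_mapClusterPt hT (Eventually.of_forall hball)
  have hS : IsCompact S := hcomp.of_isClosed_subset isClosed_setOfPred_clusterPt hSsub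
  have hne : S.Nonempty := by
    obtain ⟨T, _, hT⟩ := hcomp.exists_mapClusterPt (f := atTop) (u := P.op)
      (tendsto_principal.mpr (Eventually.of_forall hball))
    exact ⟨T, hT⟩
  obtain ⟨m, hm, hmm⟩ := exists_idempotent_in_compact_subsemigroup
    (fun r => continuous_id.mul continuous_const) S hne hS fun T₁ h₁ T₂ h₂ => by
      obtain ⟨U₁, hU₁, hT₁⟩ := mapClusterPt_iff_ultrafilter.mp h₁
      obtain ⟨U₂, hU₂, hT₂⟩ := mapClusterPt_iff_ultrafilter.mp h₂
      have h3 : Tendsto (fun p : ℝ≥0 × ℝ≥0 => P.op (p.1 + p.2)) (U₁ ×ˢ U₂) (𝓝 (T₁ * T₂)) := by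
        simp only [op_add]
        exact (hT₁.comp tendsto_fst).mul (hT₂.comp tendsto_snd)
      have h4 : Tendsto (fun p : ℝ≥0 × ℝ≥0 => p.1 + p.2)
          ((U₁ : Filter ℝ≥0) ×ˢ (U₂ : Filter ℝ≥0)) atTop :=
        tendsto_atTop_mono (fun p => le_self_add) (tendsto_fst.mono_right hU₁)
      exact h3.mapClusterPt.of_comp h4
  obtain ⟨U, hU, hT⟩ := mapClusterPt_iff_ultrafilter.mp hm
  exact ⟨m, U, hU, hT, hmm⟩

/-- A pointwise limit of completely positive maps is completely positive. -/
theorem exists_completelyPositive_of_tendsto {ι : Type*} {l : Filter ι} [l.NeBot]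
    {Φ : ι → ((H →L[ℂ] H) →CP (H →L[ℂ] H))} {m : (H →L[ℂ] H) →L[ℂ] (H →L[ℂ] H)}
    (h : ∀ X, Tendsto (fun i => Φ i X) l (𝓝 (m X))) :
    ∃ E : (H →L[ℂ] H) →CP (H →L[ℂ] H), ∀ X, E X = m X := by
  refine ⟨{ (m : (H →L[ℂ] H) →ₗ[ℂ] (H →L[ℂ] H)) with map_cstarMatrix_nonneg' := ?_ }, fun X => rfl⟩
  intro k M hM
  have h1 : Tendsto (fun i => M.map (Φ i)) l (𝓝 (M.map m)) :=
    tendsto_pi_nhds.mpr fun a => tendsto_pi_nhds.mpr fun b => h (M a b)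
  exact CStarAlgebra.isClosed_nonneg.mem_of_tendsto h1
    (Eventually.of_forall fun i => (Φ i).map_cstarMatrix_nonneg M hM)

theorem tr_map_star_mul_self_le (P : QMS H) {σ : H →L[ℂ] H} (hσ : P.IsFaithfulInvariant σ)
    (t : ℝ≥0) (X : H →L[ℂ] H) :
    (tr (σ * (star (P.map t X) * P.map t X))).re ≤ (tr (σ * (star X * X))).re := by
  have h := tr_mul_nonneg hσ.2.1.nonneg
    (sub_nonneg.mpr (star_mul_self_le_map (P.map t) (P.map_one t) X))
  rw [mul_sub, tr_sub, Complex.sub_re, hσ.2.2] at h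
  linarith

/-- A semigroup with a faithful invariant state has a conditional expectation onto its
decoherence-free algebra. It is an idempotent limit point at infinity of the semigroup. -/
theorem exists_isDFCondExp (P : QMS H) {σ : H →L[ℂ] H} (hσ : P.IsFaithfulInvariant σ) :
    ∃ E, P.IsDFCondExp E := by
  obtain ⟨m, U, hU, hm, hmm⟩ := P.exists_idempotent_limit
  have hlim : ∀ X, Tendsto (fun t => P.map t X) U (𝓝 (m X)) := fun X =>
    ((ContinuousLinearMap.apply ℂ (H →L[ℂ] H) X).continuous.tendsto _).comp hm
  obtain ⟨E, hE⟩ := exists_completelyPositive_of_tendsto hlim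
  simp only [← hE] at hlim
  have hidem : ∀ X, E (E X) = E X := fun X => by
    rw [hE, hE]
    exact congr($hmm X)
  -- On the range of `E` the norm `Tr [σ X* X]` recurs, hence is conserved.
  have hcons : ∀ X t, E X = X → P.map t (star X * X) = star (P.map t X) * P.map t X := by
    intro X t hX
    have h1 : Tendsto (fun s => (tr (σ * (star (P.map s X) * P.map s X))).re) U
        (𝓝 (tr (σ * (star X * X))).re) := by
      have h2 := hlim X
      rw [hX] at h2
      exact (Complex.continuous_re.tendsto _).comp ((continuous_tr.tendsto _).comp
        (tendsto_const_nhds.mul (((continuous_star.tendsto _).comp h2).mul h2)))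
    have h2 : (tr (σ * (star X * X))).re ≤ (tr (σ * (star (P.map t X) * P.map t X))).re := by
      refine le_of_tendsto h1 ?_
      filter_upwards [hU (eventually_ge_atTop t)] with s hs
      have h3 := P.tr_map_star_mul_self_le hσ (s - t) (P.map t X)
      rwa [← P.map_add, tsub_add_cancel_of_le hs] at h3
    rw [← sub_eq_zero]
    refine eq_zero_of_tr_mul hσ.2.1
      (sub_nonneg.mpr (star_mul_self_le_map (P.map t) (P.map_one t) X)) ?_
    have h3 := tr_mul_nonneg hσ.2.1.nonneg
      (sub_nonneg.mpr (star_mul_self_le_map (P.map t) (P.map_one t) X))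
    rw [mul_sub, tr_sub, Complex.sub_re, hσ.2.2] at h3 ⊢
    linarith
  have hsub : ∀ X, E X = X → X ∈ P.dfAlgebra := by
    intro X hX t Y
    have hXs : E (star X) = star X := by rw [StarHomClass.map_star, hX]
    refine ⟨map_star_mul_of_eq _ (P.map_one t) (hcons X t hX) Y, ?_⟩
    have h := congr_arg star (map_star_mul_of_eq _ (P.map_one t) (hcons _ t hXs) (star Y))
    rw [← map_star, star_mul, star_mul, star_star, star_star, ← map_star, ← map_star,
      star_star] at h
    rw [h, star_star]
  have hpair : ∀ X ∈ P.dfAlgebra, ∀ Z, E Z = 0 → tr (σ * (star X * Z)) = 0 := by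
    intro X hX Z hZ
    have h1 : Tendsto (fun t => tr (σ * (star (P.map t X) * P.map t Z))) U
        (𝓝 (tr (σ * (star (E X) * E Z)))) :=
      (continuous_tr.tendsto _).comp
        (tendsto_const_nhds.mul (((continuous_star.tendsto _).comp (hlim X)).mul (hlim Z)))
    simp only [← (hX _ _).1, hσ.2.2, hZ, mul_zero] at h1
    have h2 := tendsto_nhds_unique tendsto_const_nhds h1
    rw [h2]
    simp [tr]
  have hfix : ∀ X ∈ P.dfAlgebra, E X = X := by
    intro X hX
    have hZ : E (X - E X) = 0 := by rw [map_sub, hidem, sub_self]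
    have h1 := hpair X hX _ hZ
    have h2 := hpair (E X) (hsub _ (hidem X)) _ hZ
    have h3 : tr (σ * (star (X - E X) * (X - E X))) = 0 := by
      rw [star_sub, sub_mul, mul_sub, tr_sub, h1, h2, sub_zero]
    have h4 := eq_zero_of_tr_mul hσ.2.1 (star_mul_self_nonneg (X - E X)) (by rw [h3]; rfl)
    exact (sub_eq_zero.mp ((CStarRing.star_mul_self_eq_zero_iff _).mp h4)).symm
  refine ⟨E, hidem, Set.ext fun X => ⟨?_, fun hX => ⟨X, hfix X hX⟩⟩, ?_, fun X => ⟨?_, ?_⟩⟩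
  · rintro ⟨Y, rfl⟩
    exact hsub _ (hidem Y)
  · intro τ hτ X
    have h1 : Tendsto (fun t => tr (τ * P.map t X)) U (𝓝 (tr (τ * E X))) :=
      (continuous_tr.tendsto _).comp (tendsto_const_nhds.mul (hlim X))
    simp only [hτ.2.2] at h1
    exact tendsto_nhds_unique h1 tendsto_const_nhds
  · -- The semigroup is contractive, so convergence to zero along `U` is convergence to zero.
    intro hX
    have h1 := hlim X
    rw [hX] at h1
    refine Metric.tendsto_atTop.mpr fun ε hε => ?_
    obtain ⟨t, ht⟩ := (h1.eventually (Metric.ball_mem_nhds 0 hε)).exists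
    refine ⟨t, fun s hs => ?_⟩
    rw [dist_zero_right] at ht
    rw [dist_zero_right]
    refine lt_of_le_of_lt ?_ ht
    have h2 := P.norm_map_le (s - t) (P.map t X)
    rwa [← P.map_add, tsub_add_cancel_of_le hs] at h2
  · exact fun hX => tendsto_nhds_unique (hlim X) (hX.mono_left hU)

/-! ### The spectral decomposition of a reversible generator -/

theorem exists_isDFCondExp_eq_dfCondExp (P : QMS H) {σ : H →L[ℂ] H} (hσ : P.IsFaithfulInvariant σ) :
    ∃ E, P.IsDFCondExp E ∧ ∀ X, P.dfCondExp X = E X := by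
  have h := P.exists_isDFCondExp hσ
  refine ⟨h.choose, h.choose_spec, fun X => ?_⟩
  rw [dfCondExp, dif_pos h]
  rfl

theorem isUnit_of_ker_eq_bot {A : H →L[ℂ] H} (h : ∀ v, A v = 0 → v = 0) : IsUnit A := by
  have hinj : Function.Injective A := (injective_iff_map_eq_zero A).mpr h
  exact ContinuousLinearMap.isUnit_iff_bijective.mpr
    ⟨hinj, (LinearMap.injective_iff_surjective (f := (A : H →ₗ[ℂ] H))).mp hinj⟩

theorem rankOne_self_nonneg (v : H) : 0 ≤ InnerProductSpace.rankOne ℂ v v := by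
  rw [ContinuousLinearMap.nonneg_iff_isPositive]
  exact InnerProductSpace.isPositive_rankOne_self v

theorem one_mem_dfAlgebra (P : QMS H) : (1 : H →L[ℂ] H) ∈ P.dfAlgebra := fun t Y => by
  simp [P.map_one t]

theorem nontrivial_of_tr_eq_one {σ : H →L[ℂ] H} (h : tr σ = 1) : Nontrivial H := by
  by_contra hn
  rw [not_nontrivial_iff_subsingleton] at hn
  have : σ = 0 := Subsingleton.elim _ _
  rw [this] at h
  simp [tr] at h

/-- The reference state is a faithful state. -/
theorem sigmaTr_faithful (P : QMS H) {σ : H →L[ℂ] H} (hσ : P.IsFaithfulInvariant σ) :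
    IsStrictlyPositive P.sigmaTr ∧ tr P.sigmaTr = 1 := by
  obtain ⟨E, hE, hEeq⟩ := P.exists_isDFCondExp_eq_dfCondExp hσ
  have : Nontrivial H := nontrivial_of_tr_eq_one hσ.1.2
  have hd : (0 : ℝ) < Module.finrank ℂ H := by exact_mod_cast Module.finrank_pos
  have htr : ∀ X, tr (X * P.sigmaTr) = (Module.finrank ℂ H : ℂ)⁻¹ * tr (E X) := by
    intro X
    rw [sigmaTr, dfState, ← tr_map_mul, hEeq, mul_smul_comm, mul_one, tr_smul]
  have hin : ∀ v, ⟪v, P.sigmaTr v⟫_ℂ = (((Module.finrank ℂ H : ℝ)⁻¹ *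
      (tr (E (InnerProductSpace.rankOne ℂ v v))).re : ℝ) : ℂ) := by
    intro v
    have hpos : 0 ≤ E (InnerProductSpace.rankOne ℂ v v) := map_nonneg E (rankOne_self_nonneg v)
    rw [← tr_mul_rankOne, tr_mul_comm, htr]
    apply Complex.ext <;> simp [tr_im_eq_zero hpos.isSelfAdjoint, Complex.mul_re, Complex.mul_im,
      ← Complex.ofReal_natCast, ← Complex.ofReal_inv]
  have hnonneg : 0 ≤ P.sigmaTr := by
    rw [ContinuousLinearMap.nonneg_iff_isPositive, ← ContinuousLinearMap.isPositive_toLinearMap_iff,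
      LinearMap.isPositive_iff_complex]
    intro v
    have h1 : ⟪(P.sigmaTr : H →ₗ[ℂ] H) v, v⟫_ℂ = (((Module.finrank ℂ H : ℝ)⁻¹ *
      (tr (E (InnerProductSpace.rankOne ℂ v v))).re : ℝ) : ℂ) := by
      rw [← inner_conj_symm]
      change starRingEnd ℂ ⟪v, P.sigmaTr v⟫_ℂ = _
      rw [hin, Complex.conj_ofReal]
    rw [h1]
    refine ⟨by simp, ?_⟩
    rw [RCLike.re_to_complex, Complex.ofReal_re]
    exact mul_nonneg (inv_nonneg.mpr hd.le)
      (tr_nonneg (map_nonneg E (rankOne_self_nonneg v)))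
  have hunit : IsUnit P.sigmaTr := by
    refine isUnit_of_ker_eq_bot fun v hv => ?_
    have h1 := hin v
    rw [hv, inner_zero_right] at h1
    have h2 : (tr (E (InnerProductSpace.rankOne ℂ v v))).re = 0 := by
      have := Complex.ofReal_eq_zero.mp h1.symm
      exact (mul_eq_zero.mp this).resolve_left (inv_ne_zero hd.ne')
    have h3 : E (InnerProductSpace.rankOne ℂ v v) = 0 :=
      eq_zero_of_tr_mul isStrictlyPositive_one (map_nonneg E (rankOne_self_nonneg v))
        (by rwa [one_mul])
    have h4 := hE.compatible σ hσ (InnerProductSpace.rankOne ℂ v v)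
    rw [h3, mul_zero] at h4
    have h5 := eq_zero_of_tr_mul hσ.2.1 (rankOne_self_nonneg v) (by rw [← h4]; simp [tr])
    simpa using h5
  refine ⟨⟨hnonneg, hunit⟩, ?_⟩
  have h1 : E 1 = 1 := by
    obtain ⟨Y, hY⟩ : (1 : H →L[ℂ] H) ∈ Set.range E := hE.range_eq ▸ P.one_mem_dfAlgebra
    rw [← hY, hE.idem]
  have h2 := htr 1
  rw [one_mul, h1] at h2
  rw [h2]
  have h3 : tr (1 : H →L[ℂ] H) = Module.finrank ℂ H := LinearMap.trace_one ℂ H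
  rw [h3]
  exact inv_mul_cancel₀ (by exact_mod_cast hd.ne')

/-- The decoherence-free algebra is orthogonal to the vanishing observables in the GNS form of
every faithful invariant state. -/
theorem tr_star_mul_eq_zero (P : QMS H) {σ : H →L[ℂ] H} (hσ : P.IsFaithfulInvariant σ)
    {X Z : H →L[ℂ] H} (hX : X ∈ P.dfAlgebra) (hZ : Tendsto (fun t => P.map t Z) atTop (𝓝 0)) :
    tr (σ * (star X * Z)) = 0 := by
  have h1 : Tendsto (fun t => star (P.map t X) * P.map t Z) atTop (𝓝 0) := by
    refine squeeze_zero_norm (a := fun t => ‖X‖ * ‖P.map t Z‖) (fun t => ?_) ?_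
    · refine (norm_mul_le _ _).trans ?_
      rw [norm_star]
      exact mul_le_mul_of_nonneg_right (P.norm_map_le t X) (norm_nonneg _)
    · simpa using hZ.norm.const_mul ‖X‖
  have h2 : Tendsto (fun t => tr (σ * (star (P.map t X) * P.map t Z))) atTop (𝓝 (tr (σ * 0))) :=
    (continuous_tr.tendsto _).comp (tendsto_const_nhds.mul h1)
  simp only [← (hX _ _).1, hσ.2.2] at h2
  rw [tendsto_nhds_unique tendsto_const_nhds h2]
  simp [tr]

/-- The generator of a reversible semigroup has an eigenbasis that is orthonormal for the KMS form;
its eigenvalues are nonpositive, and the conditional expectation is the spectral projection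
at the eigenvalue zero. -/
theorem exists_generator_eigenbasis (P : QMS H) (hP : P.IsReversible) :
    ∃ (n : ℕ) (b : Fin n → (H →L[ℂ] H)) (κ : Fin n → ℝ),
      (∀ i, P.generator (b i) = (κ i : ℂ) • b i) ∧ (∀ i, b i ≠ 0) ∧
      (∀ X Y, kms P.sigmaTr X Y = ∑ i, star (kms P.sigmaTr (b i) X) * kms P.sigmaTr (b i) Y) ∧
      (∀ i, κ i ≤ 0) ∧
      ∀ i X, kms P.sigmaTr (b i) (P.dfCondExp X) =
        if κ i = 0 then kms P.sigmaTr (b i) X else 0 := by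
  obtain ⟨⟨σ, hσ⟩, hrev⟩ := hP
  obtain ⟨E, hE, hEeq⟩ := P.exists_isDFCondExp_eq_dfCondExp hσ
  obtain ⟨n, b, κ, hb, hon, hsum, hkms⟩ := exists_orthonormal_eigenvectors
    (kmsCore (P.sigmaTr_faithful hσ).1) (P.generator : (H →L[ℂ] H) →ₗ[ℂ] (H →L[ℂ] H))
    (P.generator_kms hrev)
  change ∀ i j, kms P.sigmaTr (b i) (b j) = if i = j then 1 else 0 at hon
  have hb0 : ∀ i, b i ≠ 0 := fun i h0 => by
    have h := hon i i
    rw [if_pos rfl, h0, kms, mul_zero] at h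
    simp [tr] at h
  have hexp : ∀ i t, P.map t (b i) = Real.exp (κ i * t) • b i := fun i t =>
    P.map_of_generator_eq_smul (hb i) t
  have hκ : ∀ i, κ i ≤ 0 := by
    intro i
    have h1 := P.norm_map_le 1 (b i)
    rw [hexp, norm_smul, Real.norm_eq_abs, Real.abs_exp] at h1
    have h2 : Real.exp (κ i * (1 : ℝ≥0)) ≤ 1 := by
      by_contra! h3
      have := norm_pos_iff.mpr (hb0 i)
      nlinarith
    simpa using h2
  have hvan : ∀ i, κ i < 0 → Tendsto (fun t => P.map t (b i)) atTop (𝓝 0) := by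
    intro i hi
    have h1 : Tendsto (fun t : ℝ≥0 => Real.exp (κ i * t)) atTop (𝓝 0) :=
      Real.tendsto_exp_atBot.comp (NNReal.tendsto_coe_atTop.mpr tendsto_id
        |>.const_mul_atTop_of_neg hi)
    simp only [hexp]
    simpa using h1.smul_const (b i)
  have hfix : ∀ X ∈ P.dfAlgebra, ∀ t, P.map t X = X := by
    intro X hX t
    have h1 : ∀ i, tr (σ * (star (P.map t X - X) * b i)) = 0 := by
      intro i
      have h2 : tr (σ * (star (P.map t X) * P.map t (b i))) = tr (σ * (star X * b i)) := by
        rw [← (hX t _).1, hσ.2.2]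
      rw [star_sub, sub_mul, mul_sub, tr_sub]
      rcases (hκ i).eq_or_lt with h0 | h0
      · rw [hexp, h0, zero_mul, Real.exp_zero, one_smul] at h2
        rw [h2, sub_self]
      · have h3 := P.tr_star_mul_eq_zero hσ hX (hvan i h0)
        rw [h3, hexp, ← Complex.coe_smul, mul_smul_comm, mul_smul_comm, tr_smul] at h2
        have h4 := (mul_eq_zero.mp h2).resolve_left
          (Complex.ofReal_ne_zero.mpr (Real.exp_pos _).ne')
        rw [h3, h4, sub_zero]
    have h2 : ∀ Z, tr (σ * (star (P.map t X - X) * Z)) = 0 := by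
      intro Z
      rw [← hsum Z]
      simp only [Finset.mul_sum, mul_smul_comm, tr_sum, tr_smul, h1, mul_zero,
        Finset.sum_const_zero]
    have h3 := eq_zero_of_tr_mul hσ.2.1 (star_mul_self_nonneg (P.map t X - X)) (by rw [h2]; rfl)
    exact sub_eq_zero.mp ((CStarRing.star_mul_self_eq_zero_iff _).mp h3)
  have hEb : ∀ i, P.dfCondExp (b i) = (if κ i = 0 then (1 : ℂ) else 0) • b i := by
    intro i
    rw [hEeq]
    rcases (hκ i).eq_or_lt with hi | hi
    swap
    · rw [if_neg hi.ne, zero_smul]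
      exact (hE.ker_iff _).mpr (hvan i hi)
    have h1 : E (b i - E (b i)) = 0 := by rw [map_sub, hE.idem, sub_self]
    have h2 := (hE.ker_iff _).mp h1
    have h3 : ∀ t, P.map t (b i - E (b i)) = b i - E (b i) := fun t => by
      rw [map_sub, hfix (E (b i)) (hE.range_eq ▸ ⟨b i, rfl⟩), hexp, hi, zero_mul, Real.exp_zero,
        one_smul]
    simp only [h3] at h2
    rw [if_pos hi, one_smul]
    exact (sub_eq_zero.mp (tendsto_nhds_unique tendsto_const_nhds h2)).symm
  refine ⟨n, b, κ, hb, hb0, hkms, hκ, fun i X => ?_⟩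
  have h1 : P.dfCondExp X = ∑ j, (kms P.sigmaTr (b j) X * if κ j = 0 then 1 else 0) • b j := by
    conv_lhs => rw [← show ∑ j, kms P.sigmaTr (b j) X • b j = X from hsum X]
    simp only [map_sum, _root_.map_smul, hEb, smul_smul]
  rw [h1, kms, Finset.mul_sum, tr_sum, Finset.sum_eq_single i]
  · rw [mul_smul_comm, tr_smul]
    change _ * kms P.sigmaTr (b i) (b i) = _
    rw [hon, if_pos rfl]
    split_ifs <;> simp
  · intro j _ hj
    rw [mul_smul_comm, tr_smul]
    change _ * kms P.sigmaTr (b i) (b j) = _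
    rw [hon, if_neg hj.symm, mul_zero]
  · simp

theorem kms_self_of_eigenbasis {ι : Type*} [Fintype ι] {σ : H →L[ℂ] H} {b : ι → (H →L[ℂ] H)}
    (hkms : ∀ X Y, kms σ X Y = ∑ i, star (kms σ (b i) X) * kms σ (b i) Y) (X : H →L[ℂ] H)
    {T : H →L[ℂ] H} {c : ι → ℝ} (hT : ∀ i, kms σ (b i) T = c i * kms σ (b i) X) :
    (kms σ X T).re = ∑ i, c i * ‖kms σ (b i) X‖ ^ 2 := by
  rw [hkms, Complex.re_sum]
  refine Finset.sum_congr rfl fun i _ => ?_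
  have h := Complex.mul_conj (kms σ (b i) X)
  rw [Complex.normSq_eq_norm_sq] at h
  have e : star (kms σ (b i) X) * kms σ (b i) T =
      ((c i * ‖kms σ (b i) X‖ ^ 2 : ℝ) : ℂ) := by
    rw [hT]
    push_cast at h ⊢
    rw [← h, starRingEnd_apply]
    ring
  rw [e, Complex.ofReal_re]

theorem exists_isSelfAdjoint_eigenvector (P : QMS H) {B : H →L[ℂ] H} {κ : ℝ} (hB0 : B ≠ 0)
    (hB : P.generator B = (κ : ℂ) • B) :
    ∃ X, IsSelfAdjoint X ∧ X ≠ 0 ∧ P.generator X = (κ : ℂ) • X := by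
  have hBs : P.generator (star B) = (κ : ℂ) • star B := by
    rw [generator_star, hB, star_smul]
    simp
  by_cases h : B + star B = 0
  · refine ⟨Complex.I • (B - star B), ?_, fun h0 => hB0 ?_, ?_⟩
    · rw [isSelfAdjoint_iff, star_smul, star_sub, star_star]
      simp only [RCLike.star_def, Complex.conj_I, neg_smul, smul_sub]
      abel
    · have h1 := (smul_eq_zero.mp h0).resolve_left Complex.I_ne_zero
      have h2 : (2 : ℂ) • B = 0 := by
        rw [two_smul]
        calc B + B = (B + star B) + (B - star B) := by abel
          _ = 0 := by rw [h, h1, add_zero]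
      exact (smul_eq_zero.mp h2).resolve_left two_ne_zero
    · rw [_root_.map_smul, map_sub, hB, hBs, ← smul_sub, smul_comm]
  · exact ⟨B + star B, .add_star_self B, h, by rw [_root_.map_add, hB, hBs, smul_add]⟩

theorem le_spectralGap (P : QMS H) {c : ℝ} (hc : P.PoincareIneq c) : (c : EReal) ≤ P.spectralGap :=
  le_iSup₂_of_le c hc le_rfl

/-! ### Klein's inequality with remainder -/

theorem finite_spectrum_real (A : H →L[ℂ] H) : (spectrum ℝ A).Finite := by
  have h1 : (spectrum ℂ A).Finite := by
    have := Module.End.finite_spectrum (A : H →ₗ[ℂ] H)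
    rwa [← AlgEquiv.spectrum_eq (Module.End.toContinuousLinearMap H)] at this
  rw [← spectrum.preimage_algebraMap ℂ]
  exact h1.preimage (algebraMap ℝ ℂ).injective.injOn

theorem aeval_apply_eigenvector (A : H →L[ℂ] H) (p : Polynomial ℝ) {u : H} {a : ℝ}
    (h : A u = (a : ℂ) • u) : Polynomial.aeval A p u = ((p.eval a : ℝ) : ℂ) • u := by
  induction p using Polynomial.induction_on' with
  | add p q hp hq => 
    simp only [_root_.map_add, add_apply, hp, hq, Polynomial.eval_add, Complex.ofReal_add, add_smul]
  | monomial n c =>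
    have hn : ∀ n : ℕ, (A ^ n) u = ((a : ℂ) ^ n) • u := by
      intro n
      induction n with
      | zero => simp
      | succ n ih =>
        rw [pow_succ]
        change (A ^ n) (A u) = _
        rw [h, map_smul, ih, smul_smul, pow_succ, mul_comm]
    rw [Polynomial.aeval_monomial, Polynomial.eval_monomial, ← Algebra.smul_def]
    change c • (A ^ n) u = _
    rw [hn, ← Complex.coe_smul, smul_smul]
    push_cast
    rfl

/-- The functional calculus acts on an eigenvector through the eigenvalue. -/
theorem cfc_apply_eigenvector {A : H →L[ℂ] H} (hA : IsSelfAdjoint A) (f : ℝ → ℝ) {u : H}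
    (hu : u ≠ 0) {a : ℝ} (h : A u = (a : ℂ) • u) : cfc f A u = ((f a : ℝ) : ℂ) • u := by
  have ha : a ∈ spectrum ℝ A := by
    intro hunit
    have h0 : (algebraMap ℝ (H →L[ℂ] H) a - A) u = 0 := by
      rw [Algebra.algebraMap_eq_smul_one]
      change a • u - A u = 0
      rw [h, Complex.coe_smul, sub_self]
    obtain ⟨B, hB⟩ := hunit.exists_left_inv
    apply hu
    calc u = (B * (algebraMap ℝ (H →L[ℂ] H) a - A)) u := by rw [hB]; rfl
      _ = B ((algebraMap ℝ (H →L[ℂ] H) a - A) u) := rfl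
      _ = 0 := by rw [h0, _root_.map_zero]
  -- The spectrum is finite, so `f` agrees there with an interpolation polynomial.
  let s := (finite_spectrum_real A).toFinset
  let p := Lagrange.interpolate s id f
  have hp : ∀ x ∈ spectrum ℝ A, f x = p.eval x := fun x hx =>
    (Lagrange.eval_interpolate_at_node f Function.injective_id.injOn
      ((finite_spectrum_real A).mem_toFinset.mpr hx)).symm
  rw [cfc_congr hp, cfc_polynomial p A hA, aeval_apply_eigenvector A p h, hp a ha]

theorem tr_mul_of_eigenbases {ι ι' : Type*} [Fintype ι] [Fintype ι'] (u : OrthonormalBasis ι ℂ H)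
    (v : OrthonormalBasis ι' ℂ H) {F G : H →L[ℂ] H} {f : ι → ℝ} {g : ι' → ℝ}
    (hF : ∀ i, F (u i) = (f i : ℂ) • u i) (hG : ∀ j, G (v j) = (g j : ℂ) • v j) :
    (tr (F * G)).re = ∑ i, ∑ j, ‖⟪v j, u i⟫_ℂ‖ ^ 2 * (f i * g j) := by
  have key : tr (F * G) = ((∑ i, ∑ j, ‖⟪v j, u i⟫_ℂ‖ ^ 2 * (f i * g j) : ℝ) : ℂ) := by
    rw [tr_mul_comm, tr_eq_sum_inner u, Complex.ofReal_sum]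
    refine Finset.sum_congr rfl fun i _ => ?_
    change ⟪u i, G (F (u i))⟫_ℂ = _
    have h1 : G (u i) = ∑ j, (⟪v j, u i⟫_ℂ * (g j : ℂ)) • v j := by
      conv_lhs => rw [← v.sum_repr' (u i)]
      simp only [map_sum, map_smul, hG, smul_smul]
    rw [hF, map_smul, inner_smul_right, h1, inner_sum, Finset.mul_sum, Complex.ofReal_sum]
    refine Finset.sum_congr rfl fun j _ => ?_
    rw [inner_smul_right, ← inner_conj_symm (u i) (v j)]
    have := Complex.mul_conj ⟪v j, u i⟫_ℂ
    rw [Complex.normSq_eq_norm_sq] at this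
    push_cast at this ⊢
    linear_combination (f i * g j : ℂ) * this
  rw [key, Complex.ofReal_re]

theorem quarter_sq_sub_le {x y : ℝ} (hx : 0 < x) (hy : 0 < y) (hx1 : x ≤ 1) (hy1 : y ≤ 1) :
    (x - y) ^ 2 / 4 ≤ x * Real.log x - x * Real.log y - x + y := by
  -- `log u ≥ 2 (1 - u^{-1/2})` turns the right-hand side into a Hellinger distance.
  obtain ⟨a, ha, rfl⟩ : ∃ a : ℝ, 0 < a ∧ x = a ^ 2 :=
    ⟨√x, Real.sqrt_pos.mpr hx, (Real.sq_sqrt hx.le).symm⟩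
  obtain ⟨b, hb, rfl⟩ : ∃ b : ℝ, 0 < b ∧ y = b ^ 2 :=
    ⟨√y, Real.sqrt_pos.mpr hy, (Real.sq_sqrt hy.le).symm⟩
  have ha1 : a ≤ 1 := by nlinarith
  have hb1 : b ≤ 1 := by nlinarith
  have hlog : 1 - b / a ≤ Real.log a - Real.log b := by
    have := Real.one_sub_inv_le_log_of_pos (div_pos ha hb)
    rwa [Real.log_div ha.ne' hb.ne', inv_div] at this
  have h1 : a ^ 2 * (1 - b / a) ≤ a ^ 2 * (Real.log a - Real.log b) := by gcongr
  have h2 : a ^ 2 * (1 - b / a) = a ^ 2 - a * b := by field_simp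
  have h3 : (a + b) ^ 2 ≤ 4 := by nlinarith
  have h4 : (a - b) ^ 2 * (a + b) ^ 2 ≤ (a - b) ^ 2 * 4 := by gcongr
  rw [Real.log_pow, Real.log_pow]
  push_cast
  nlinarith

/-- A strictly positive state has an orthonormal eigenbasis with eigenvalues in `(0, 1]`. -/
theorem exists_eigenbasis {ρ : H →L[ℂ] H} (hρ : IsStrictlyPositive ρ) (h1 : tr ρ = 1) :
    ∃ (u : OrthonormalBasis (Fin (Module.finrank ℂ H)) ℂ H) (a : Fin (Module.finrank ℂ H) → ℝ),
      (∀ i, ρ (u i) = (a i : ℂ) • u i) ∧ (∀ i, 0 < a i) ∧ ∀ i, a i ≤ 1 := by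
  have hpos : ρ.IsPositive := (ContinuousLinearMap.nonneg_iff_isPositive ρ).mp hρ.nonneg
  have hsym : (ρ : H →ₗ[ℂ] H).IsSymmetric := hpos.isSymmetric
  let u := hsym.eigenvectorBasis rfl
  let a := hsym.eigenvalues rfl
  have hu : ∀ i, ρ (u i) = (a i : ℂ) • u i := fun i => hsym.apply_eigenvectorBasis rfl i
  have hin : ∀ i, ⟪u i, ρ (u i)⟫_ℂ = (a i : ℂ) := fun i => by
    rw [hu, inner_smul_right, inner_self_eq_norm_sq_to_K, u.orthonormal.1 i]; simp
  have ha0 : ∀ i, 0 < a i := by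
    intro i
    have h2 := hpos.re_inner_nonneg_right (u i)
    rw [hin] at h2
    refine lt_of_le_of_ne (by simpa using h2) fun h0 => u.orthonormal.ne_zero i ?_
    obtain ⟨B, hB⟩ := hρ.isUnit.exists_left_inv
    calc u i = (B * ρ) (u i) := by rw [hB]; rfl
      _ = B (ρ (u i)) := rfl
      _ = 0 := by rw [hu, ← h0]; simp
  refine ⟨u, a, hu, ha0, fun i => ?_⟩
  have hs : ∑ i, a i = 1 := by
    rw [tr_eq_sum_inner u] at h1
    simp only [hin] at h1
    exact_mod_cast h1
  rw [← hs]
  exact Finset.single_le_sum (fun j _ => (ha0 j).le) (Finset.mem_univ i)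

/-- Klein's inequality with a quadratic remainder (a weak form of Pinsker's inequality). -/
theorem quarter_tr_sq_le_relEntropy {ρ τ : H →L[ℂ] H} (hρ : IsStrictlyPositive ρ)
    (hτ : IsStrictlyPositive τ) (hρ1 : tr ρ = 1) (hτ1 : tr τ = 1) :
    (tr ((ρ - τ) * (ρ - τ))).re / 4 ≤ (tr (ρ * (CFC.log ρ - CFC.log τ))).re := by
  obtain ⟨u, a, hu, ha0, ha1⟩ := exists_eigenbasis hρ hρ1
  obtain ⟨v, t, hv, ht0, ht1⟩ := exists_eigenbasis hτ hτ1
  have hul : ∀ i, CFC.log ρ (u i) = ((Real.log (a i) : ℝ) : ℂ) • u i := fun i =>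
    cfc_apply_eigenvector hρ.isSelfAdjoint _ (u.orthonormal.ne_zero i) (hu i)
  have hvl : ∀ j, CFC.log τ (v j) = ((Real.log (t j) : ℝ) : ℂ) • v j := fun j =>
    cfc_apply_eigenvector hτ.isSelfAdjoint _ (v.orthonormal.ne_zero j) (hv j)
  have one_apply : ∀ w : H, (1 : H →L[ℂ] H) w = ((1 : ℝ) : ℂ) • w := fun w => by simp
  have e1 : (tr (ρ * CFC.log ρ * 1)).re = _ := tr_mul_of_eigenbases u v
    (f := fun i => a i * Real.log (a i)) (g := fun _ => 1) (fun i => by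
      change ρ (CFC.log ρ (u i)) = _
      rw [hul, map_smul, hu, smul_smul]; push_cast; rw [mul_comm]) fun j => one_apply _
  have e2 : (tr (ρ * CFC.log τ)).re = _ := tr_mul_of_eigenbases u v hu hvl
  have e3 : (tr (ρ * 1)).re = _ := tr_mul_of_eigenbases u v hu fun j => one_apply _
  have e4 : (tr (1 * τ)).re = _ := tr_mul_of_eigenbases u v (fun j => one_apply _) hv
  have e5 : (tr (ρ * ρ * 1)).re = _ := tr_mul_of_eigenbases u v
    (f := fun i => a i * a i) (g := fun _ => 1) (fun i => by
      change ρ (ρ (u i)) = _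
      rw [hu, map_smul, hu, smul_smul]; push_cast; rfl) fun j => one_apply _
  have e6 : (tr (ρ * τ)).re = _ := tr_mul_of_eigenbases u v hu hv
  have e7 : (tr (1 * (τ * τ))).re = _ := tr_mul_of_eigenbases u v
    (g := fun i => t i * t i) (fun j => one_apply _) (fun i => by
      change τ (τ (v i)) = _
      rw [hv, map_smul, hv, smul_smul]; push_cast; rfl)
  rw [mul_one] at e1 e3 e5
  rw [one_mul] at e4 e7
  rw [hρ1] at e3
  rw [hτ1] at e4
  have d1 : (tr (ρ * (CFC.log ρ - CFC.log τ))).re =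
      ∑ i, ∑ j, ‖⟪v j, u i⟫_ℂ‖ ^ 2 * (a i * Real.log (a i) - a i * Real.log (t j) - a i + t j) := by
    rw [mul_sub, tr_sub, Complex.sub_re, e1, e2,
      ← add_sub_cancel_right (∑ i, _) (1 : ℂ).re]
    nth_rw 1 [e4]
    rw [e3]
    simp only [← Finset.sum_add_distrib, ← Finset.sum_sub_distrib]
    refine Finset.sum_congr rfl fun i _ => Finset.sum_congr rfl fun j _ => by ring
  have d2 : (tr ((ρ - τ) * (ρ - τ))).re =
      ∑ i, ∑ j, ‖⟪v j, u i⟫_ℂ‖ ^ 2 * (a i - t j) ^ 2 := by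
    rw [sub_mul, mul_sub, mul_sub, tr_sub, tr_sub, tr_sub, tr_mul_comm τ ρ]
    simp only [Complex.sub_re]
    rw [e5, e6, e7]
    simp only [← Finset.sum_sub_distrib]
    refine Finset.sum_congr rfl fun i _ => Finset.sum_congr rfl fun j _ => by ring
  rw [d1, d2, Finset.sum_div]
  refine Finset.sum_le_sum fun i _ => ?_
  rw [Finset.sum_div]
  refine Finset.sum_le_sum fun j _ => ?_
  rw [mul_div_assoc]
  gcongr
  exact quarter_sq_sub_le (ha0 i) (ht0 j) (ha1 i) (ht1 j)

/-! ### The entropy along a ray of states -/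

/-- A function `f` with subgradient `g` on `(0, ε₀]` that dominates `δ a²` cannot satisfy
`b g(b) ≥ 2 κ f(b)` throughout with `κ > 1`: iterating the subgradient inequality along
a geometric sequence would make `f` decay faster than quadratically. -/
theorem exists_mul_subgradient_lt {f g : ℝ → ℝ} {ε₀ δ κ : ℝ} (hε : 0 < ε₀) (hδ : 0 < δ) (hκ : 1 < κ)
    (hsub : ∀ a b, 0 < a → a ≤ ε₀ → 0 < b → b ≤ ε₀ → f b + (a - b) * g b ≤ f a)
    (hlow : ∀ a, 0 < a → a ≤ ε₀ → δ * a ^ 2 ≤ f a) :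
    ∃ b, 0 < b ∧ b ≤ ε₀ ∧ b * g b < 2 * κ * f b := by
  by_contra! hcon
  -- The growth factor `1 + 2 κ h` beats `(1 + h)²` exactly when `h < 2 (κ - 1)`.
  set h := κ - 1 with hh
  have hh0 : 0 < h := by linarith
  have step : ∀ b, 0 < b → (1 + h) * b ≤ ε₀ → (1 + 2 * κ * h) * f b ≤ f ((1 + h) * b) := by
    intro b hb hbε
    have hb' : b ≤ ε₀ := by nlinarith
    have h1 := hsub ((1 + h) * b) b (by positivity) hbε hb hb'
    have h2 := hcon b hb hb'
    nlinarith
  have iter : ∀ n : ℕ, (1 + 2 * κ * h) ^ n * f (ε₀ / (1 + h) ^ n) ≤ f ε₀ := by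
    intro n
    induction n with
    | zero => simp
    | succ n ih =>
      refine le_trans ?_ ih
      have e : (1 + h) * (ε₀ / (1 + h) ^ (n + 1)) = ε₀ / (1 + h) ^ n := by
        field_simp
        ring
      have h1 := step (ε₀ / (1 + h) ^ (n + 1)) (by positivity) (by
        rw [e]
        exact div_le_self hε.le (one_le_pow₀ (by linarith)))
      rw [e] at h1
      have hk : 0 ≤ (1 + 2 * κ * h) ^ n := by positivity
      rw [pow_succ, mul_assoc]
      exact mul_le_mul_of_nonneg_left h1 hk
  have hq : 1 < (1 + 2 * κ * h) / (1 + h) ^ 2 := by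
    rw [one_lt_div (by positivity)]
    nlinarith
  obtain ⟨n, hn⟩ := pow_unbounded_of_one_lt (f ε₀ / (δ * ε₀ ^ 2)) hq
  have h1 := hlow (ε₀ / (1 + h) ^ n) (by positivity)
    (div_le_self hε.le (one_le_pow₀ (by linarith)))
  have h2 : (1 + 2 * κ * h) ^ n * (δ * (ε₀ / (1 + h) ^ n) ^ 2) ≤ f ε₀ :=
    le_trans (mul_le_mul_of_nonneg_left h1 (by positivity)) (iter n)
  rw [div_lt_iff₀ (by positivity)] at hn
  have e : ((1 + 2 * κ * h) / (1 + h) ^ 2) ^ n * (δ * ε₀ ^ 2) =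
      (1 + 2 * κ * h) ^ n * (δ * (ε₀ / (1 + h) ^ n) ^ 2) := by
    rw [div_pow, div_pow, ← pow_mul, ← pow_mul, mul_comm 2 n]
    field_simp
  linarith

theorem predual_add (T : (H →L[ℂ] H) →ₗ[ℂ] (H →L[ℂ] H)) (Y Z : H →L[ℂ] H) :
    predual T (Y + Z) = predual T Y + predual T Z :=
  (predual_unique T _ _ fun X => by
    rw [mul_add, mul_add, tr_add, tr_add, tr_map_mul, tr_map_mul]).symm

theorem predual_smul (T : (H →L[ℂ] H) →ₗ[ℂ] (H →L[ℂ] H)) (c : ℂ) (Y : H →L[ℂ] H) :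
    predual T (c • Y) = c • predual T Y :=
  (predual_unique T _ _ fun X => by
    rw [mul_smul_comm, mul_smul_comm, tr_smul, tr_smul, tr_map_mul]).symm

/-- The operator `σ^{1/2} X σ^{1/2}`, which represents the observable `X` in the KMS form. -/
def sandwich (σ X : H →L[ℂ] H) : H →L[ℂ] H := CFC.sqrt σ * X * CFC.sqrt σ

theorem sandwich_one {σ : H →L[ℂ] H} (hσ : 0 ≤ σ) : sandwich σ 1 = σ := by
  rw [sandwich, mul_one, CFC.sqrt_mul_sqrt_self σ hσ]

theorem isSelfAdjoint_sandwich (σ : H →L[ℂ] H) {X : H →L[ℂ] H} (hX : IsSelfAdjoint X) :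
    IsSelfAdjoint (sandwich σ X) := by
  have hs : star (CFC.sqrt σ) = CFC.sqrt σ := (CFC.sqrt_nonneg σ).isSelfAdjoint
  rw [isSelfAdjoint_iff, sandwich, star_mul, star_mul, hs, hX.star_eq, mul_assoc]

theorem tr_mul_sandwich (σ : H →L[ℂ] H) {X : H →L[ℂ] H} (hX : IsSelfAdjoint X) (Y : H →L[ℂ] H) :
    tr (Y * sandwich σ X) = kms σ X Y := by
  rw [kms, hX.star_eq, tr_mul_comm, sandwich]

theorem predual_sandwich {σ X : H →L[ℂ] H} (hX : IsSelfAdjoint X)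
    (T : (H →L[ℂ] H) →ₗ[ℂ] (H →L[ℂ] H)) {c : ℂ} (h : ∀ Y, kms σ X (T Y) = c * kms σ X Y) :
    predual T (sandwich σ X) = c • sandwich σ X :=
  (predual_unique T _ _ fun Y => by
    rw [mul_smul_comm, tr_smul, tr_mul_sandwich σ hX, tr_mul_sandwich σ hX, h]).symm

theorem sandwich_ne_zero {σ X : H →L[ℂ] H} (hσ : IsStrictlyPositive σ) (hX : X ≠ 0) :
    sandwich σ X ≠ 0 := fun h => by
  have hu : IsUnit (CFC.sqrt σ) := IsStrictlyPositive.isUnit_cfcSqrt _ hσ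
  exact hX (hu.mul_right_eq_zero.mp (hu.mul_left_eq_zero.mp h))

theorem exists_isStrictlyPositive_add_smul [Nontrivial H] {σ Y : H →L[ℂ] H}
    (hσ : IsStrictlyPositive σ) (hY : IsSelfAdjoint Y) :
    ∃ ε₀ : ℝ, 0 < ε₀ ∧ ∀ ε : ℝ, 0 < ε → ε ≤ ε₀ → IsStrictlyPositive (σ + (ε : ℂ) • Y) := by
  obtain ⟨r, hr, hrσ⟩ := (CFC.exists_pos_algebraMap_le_iff hσ.isSelfAdjoint).mpr fun x hx =>
    hσ.spectrum_pos (𝕜 := ℝ) hx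
  refine ⟨r / (2 * (‖Y‖ + 1)), by positivity, fun ε hε hε' => ?_⟩
  have hr2 : IsStrictlyPositive (algebraMap ℝ (H →L[ℂ] H) (r / 2)) :=
    isStrictlyPositive_algebraMap (by positivity)
  refine hr2.of_le ?_
  have h1 : -algebraMap ℝ (H →L[ℂ] H) (ε * ‖Y‖) ≤ (ε : ℂ) • Y := by
    have h2 := smul_le_smul_of_nonneg_left hY.neg_algebraMap_norm_le_self hε.le
    rwa [smul_neg, Algebra.smul_def, ← _root_.map_mul, ← Complex.coe_smul] at h2
  have h2 : ε * ‖Y‖ ≤ r / 2 := by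
    rw [le_div_iff₀ (by positivity)] at hε'
    nlinarith [norm_nonneg Y]
  have h3 : algebraMap ℝ (H →L[ℂ] H) (ε * ‖Y‖) ≤ algebraMap ℝ (H →L[ℂ] H) (r / 2) :=
    algebraMap_mono _ h2
  calc algebraMap ℝ (H →L[ℂ] H) (r / 2)
      = algebraMap ℝ (H →L[ℂ] H) r + -algebraMap ℝ (H →L[ℂ] H) (r / 2) := by
        rw [← _root_.map_neg, ← _root_.map_add]; congr 1; ring
    _ ≤ algebraMap ℝ (H →L[ℂ] H) r + -algebraMap ℝ (H →L[ℂ] H) (ε * ‖Y‖) := by gcongr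
    _ ≤ σ + (ε : ℂ) • Y := add_le_add hrσ h1

theorem eq_zero_of_isStrictlyPositive {A : H →L[ℂ] H} (hA : IsStrictlyPositive A) {v : H}
    (hv : A v = 0) : v = 0 := by
  obtain ⟨B, hB⟩ := hA.isUnit.exists_left_inv
  calc v = (B * A) v := by rw [hB]; rfl
    _ = B (A v) := rfl
    _ = 0 := by rw [hv, _root_.map_zero]

/-- An eigenvector of the generator at `-μ ≠ 0` bounds the modified log-Sobolev constant by `μ`.
On the ray `ρ_ε = σ + ε σ^{1/2} X σ^{1/2}` the relative entropy `f` and the entropy production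
are linked by `EP(ρ_ε) = μ ε g(ε)`, where `g` is a subgradient of `f`, while Klein's inequality
keeps `f(ε)` above a multiple of `ε²`. -/
theorem logSobolevConst_le_of_eigenvector (P : QMS H) (hσ : IsStrictlyPositive P.sigmaTr)
    (hσ1 : tr P.sigmaTr = 1) {X : H →L[ℂ] H} (hX : IsSelfAdjoint X) (hX0 : X ≠ 0) {μ : ℝ}
    (hμ : 0 < μ) (hL1 : ∀ Y, kms P.sigmaTr 1 (P.generator Y) = 0)
    (hLX : ∀ Y, kms P.sigmaTr X (P.generator Y) = -(μ : ℂ) * kms P.sigmaTr X Y)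
    (hE1 : ∀ Y, kms P.sigmaTr 1 (P.dfCondExp Y) = kms P.sigmaTr 1 Y)
    (hEX : ∀ Y, kms P.sigmaTr X (P.dfCondExp Y) = 0) :
    P.logSobolevConst ≤ μ := by
  have : Nontrivial H := nontrivial_of_tr_eq_one hσ1
  set σ := P.sigmaTr with hσdef
  set Y := sandwich σ X with hYdef
  have hY : IsSelfAdjoint Y := isSelfAdjoint_sandwich σ hX
  have hY0 : Y ≠ 0 := sandwich_ne_zero hσ hX0
  have hs1 : sandwich σ 1 = σ := sandwich_one hσ.nonneg
  -- The action of `L_*` and `E_{N*}` on the ray.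
  have hLσ : P.preGenerator σ = 0 := by
    have h := predual_sandwich (σ := σ) (.one _) (P.generator : (H →L[ℂ] H) →ₗ[ℂ] (H →L[ℂ] H))
      (c := 0) fun Z => by rw [zero_mul]; exact hL1 Z
    rwa [hs1, zero_smul] at h
  have hLY : P.preGenerator Y = -(μ : ℂ) • Y :=
    predual_sandwich hX (P.generator : (H →L[ℂ] H) →ₗ[ℂ] (H →L[ℂ] H)) hLX
  have hEσ : P.dfState σ = σ := by
    have h := predual_sandwich (σ := σ) (.one _) P.dfCondExp (c := 1) fun Z => by
      rw [one_mul]; exact hE1 Z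
    rwa [hs1, one_smul] at h
  have hEY : P.dfState Y = 0 := by
    have h := predual_sandwich hX P.dfCondExp (c := 0) fun Z => by rw [zero_mul]; exact hEX Z
    rwa [zero_smul] at h
  have htrY : tr Y = 0 := by
    have h := hLX 1
    have h1 := tr_mul_sandwich σ hX 1
    rw [one_mul] at h1
    have h2 : kms σ X (P.generator 1) = 0 := by
      rw [P.generator_one, kms, mul_zero]
      simp [tr]
    rw [h2] at h
    rw [← hYdef] at h1
    rw [h1]
    exact (mul_eq_zero.mp h.symm).resolve_left (neg_ne_zero.mpr (Complex.ofReal_ne_zero.mpr hμ.ne'))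
  obtain ⟨ε₀, hε₀, hpos⟩ := exists_isStrictlyPositive_add_smul hσ hY
  let ρ : ℝ → (H →L[ℂ] H) := fun ε => σ + (ε : ℂ) • Y
  have hρ1 : ∀ ε, tr (ρ ε) = 1 := fun ε => by rw [tr_add, tr_smul, htrY, mul_zero, add_zero, hσ1]
  let f : ℝ → ℝ := fun ε => (tr (ρ ε * (CFC.log (ρ ε) - CFC.log σ))).re
  let g : ℝ → ℝ := fun ε => (tr (Y * (CFC.log (ρ ε) - CFC.log σ))).re
  have hq : 0 < (tr (Y * Y)).re := by
    have h1 := tr_star_mul_self_nonneg Y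
    have h2 := fun h => hY0 (eq_zero_of_tr_star_mul_self (X := Y) h)
    rw [hY.star_eq] at h1 h2
    exact lt_of_le_of_ne h1 (Ne.symm h2)
  have hdiff : ∀ a b : ℝ, ρ a - ρ b = ((a - b : ℝ) : ℂ) • Y := fun a b => by
    simp only [ρ, Complex.ofReal_sub, sub_smul]; abel
  have hsq : ∀ a : ℝ, (tr (((a : ℂ) • Y) * ((a : ℂ) • Y))).re = a ^ 2 * (tr (Y * Y)).re := by
    intro a
    rw [smul_mul_smul_comm, tr_smul, ← Complex.ofReal_mul, Complex.re_ofReal_mul, sq]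
  have hsub : ∀ a b, 0 < a → a ≤ ε₀ → 0 < b → b ≤ ε₀ → f b + (a - b) * g b ≤ f a := by
    intro a b ha ha' hb hb'
    have h1 := quarter_tr_sq_le_relEntropy (hpos a ha ha') (hpos b hb hb') (hρ1 a) (hρ1 b)
    change (tr ((ρ a - ρ b) * (ρ a - ρ b))).re / 4 ≤
      (tr (ρ a * (CFC.log (ρ a) - CFC.log (ρ b)))).re at h1
    rw [hdiff, hsq] at h1
    have h2 : f a - f b - (a - b) * g b = (tr (ρ a * (CFC.log (ρ a) - CFC.log (ρ b)))).re := by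
      have e : ρ a * (CFC.log (ρ a) - CFC.log (ρ b)) = ρ a * (CFC.log (ρ a) - CFC.log σ) -
          ρ b * (CFC.log (ρ b) - CFC.log σ) -
          ((a - b : ℝ) : ℂ) • (Y * (CFC.log (ρ b) - CFC.log σ)) := by
        rw [← smul_mul_assoc, ← hdiff]
        noncomm_ring
      rw [e, tr_sub, tr_sub, tr_smul, Complex.sub_re, Complex.sub_re, Complex.re_ofReal_mul]
    have h3 : 0 ≤ (a - b) ^ 2 * (tr (Y * Y)).re / 4 := by positivity
    linarith
  have hlow : ∀ a, 0 < a → a ≤ ε₀ → (tr (Y * Y)).re / 4 * a ^ 2 ≤ f a := by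
    intro a ha ha'
    have h1 := quarter_tr_sq_le_relEntropy (hpos a ha ha') hσ (hρ1 a) hσ1
    rw [add_sub_cancel_left, hsq] at h1
    change _ ≤ f a at h1
    linarith
  refine EReal.le_of_forall_lt_iff_le.mp fun c hc => ?_
  have hc' : μ < c := EReal.coe_lt_coe_iff.mp hc
  obtain ⟨b, hb, hb', hlt⟩ := exists_mul_subgradient_lt hε₀ (by positivity)
    ((one_lt_div hμ).mpr hc') hsub hlow
  have hfb : 0 < f b := lt_of_lt_of_le (by positivity) (hlow b hb hb')
  have hρpos : IsStrictlyPositive (ρ b) := hpos b hb hb'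
  have hD : P.dfRelEntropy (ρ b) = (f b : EReal) := by
    have h1 : P.dfState (ρ b) = σ := by
      change predual _ (σ + (b : ℂ) • Y) = σ
      rw [predual_add, predual_smul]
      change P.dfState σ + (b : ℂ) • P.dfState Y = σ
      rw [hEσ, hEY, smul_zero, add_zero]
    rw [dfRelEntropy, h1, relEntropy, if_pos]
    intro v hv
    rw [eq_zero_of_isStrictlyPositive hσ hv, _root_.map_zero]
  have hEP : P.entropyProduction (ρ b) = ((μ * (b * g b) : ℝ) : EReal) := by
    rw [entropyProduction, if_pos]
    · congr 1
      have h1 : P.preGenerator (ρ b) = ((-(μ * b) : ℝ) : ℂ) • Y := by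
        change predual _ (σ + (b : ℂ) • Y) = _
        rw [predual_add, predual_smul]
        change P.preGenerator σ + (b : ℂ) • P.preGenerator Y = _
        rw [hLσ, hLY, zero_add, smul_smul]
        congr 1
        push_cast
        ring
      rw [h1, smul_mul_assoc, tr_smul, Complex.re_ofReal_mul]
      change -(-(μ * b) * g b) = _
      ring
    · intro v hv
      rw [eq_zero_of_isStrictlyPositive hρpos hv, inner_zero_left]
  have hle : P.logSobolevConst ≤ P.entropyProduction (ρ b) / (2 * P.dfRelEntropy (ρ b)) :=
    iInf_le_of_le (ρ b) (iInf_le_of_le ⟨hρpos.nonneg, hρ1 b⟩ (iInf_le _ (by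
      rw [hD]; exact EReal.coe_ne_zero.mpr hfb.ne')))
  refine hle.trans ?_
  have h2 : (2 : EReal) = ((2 : ℝ) : EReal) := rfl
  rw [hD, hEP, h2, ← EReal.coe_mul, ← EReal.coe_div, EReal.coe_le_coe_iff,
    div_le_iff₀ (by positivity)]
  have h3 : μ * (b * g b) ≤ μ * (2 * (c / μ) * f b) := mul_le_mul_of_nonneg_left hlt.le hμ.le
  have h4 : μ * (2 * (c / μ) * f b) = c * (2 * f b) := by field_simp
  linarith

end QMS

end

theorem theorem3p3 {H : Type*} [NormedAddCommGroup H] [InnerProductSpace ℂ H]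
    [FiniteDimensional ℂ H] [CompleteSpace H] (P : QMS H) (hP : P.IsReversible) :
    P.logSobolevConst ≤ P.spectralGap := by
  obtain ⟨n, b, κ, hb, hb0, hkms, hκ, hE⟩ := P.exists_generator_eigenbasis hP
  have hsym := P.generator_kms hP.2
  have hL : ∀ i X, QMS.kms P.sigmaTr (b i) (P.generator X) = κ i * QMS.kms P.sigmaTr (b i) X := by
    intro i X
    rw [← hsym, hb, ← QMS.star_kms, QMS.kms_smul_right, star_mul', QMS.star_kms]
    simp
  -- In the eigenbasis the Dirichlet form and the variance are sums of squares.
  have hpoinc : ∀ c : ℝ, (∀ i, κ i ≠ 0 → c ≤ -κ i) → P.PoincareIneq c := by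
    intro c hc X _
    rw [QMS.dfVariance, QMS.dirichlet, QMS.kms_self_of_eigenbasis hkms X (fun i => hL i X),
      QMS.kms_self_of_eigenbasis hkms _ (c := fun _ => 1) fun i => by simp, Finset.mul_sum,
      ← Finset.sum_neg_distrib]
    refine Finset.sum_le_sum fun i _ => ?_
    have h1 : QMS.kms P.sigmaTr (b i) (X - P.dfCondExp X) =
        if κ i = 0 then 0 else QMS.kms P.sigmaTr (b i) X := by
      have h2 := QMS.kms_add_right P.sigmaTr (b i) (X - P.dfCondExp X) (P.dfCondExp X)
      rw [sub_add_cancel, hE] at h2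
      split_ifs at h2 ⊢ with h0
      · simpa using h2.symm
      · simpa using h2.symm
    rw [h1]
    split_ifs with h0
    · simp [h0]
    · have h3 := mul_le_mul_of_nonneg_right (hc i h0)
        (sq_nonneg ‖QMS.kms P.sigmaTr (b i) X‖)
      linarith
  by_cases hall : ∀ i, κ i = 0
  · -- The semigroup is trivial, and every constant is admissible.
    have htop : P.spectralGap = ⊤ := EReal.eq_top_iff_forall_lt _ |>.mpr fun y =>
      lt_of_lt_of_le (EReal.coe_lt_coe_iff.mpr (lt_add_one y))
        (P.le_spectralGap (hpoinc (y + 1) fun i hi => absurd (hall i) hi))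
    rw [htop]
    exact le_top
  push Not at hall
  obtain ⟨i₁, hi₁⟩ := hall
  obtain ⟨i₀, hi₀, hmin⟩ := Finset.exists_min_image (Finset.univ.filter fun i => κ i ≠ 0)
    (fun i => -κ i) ⟨i₁, by simpa using hi₁⟩
  simp only [Finset.mem_filter, Finset.mem_univ, true_and] at hi₀ hmin
  have hμ : 0 < -κ i₀ := neg_pos.mpr (lt_of_le_of_ne (hκ i₀) hi₀)
  refine le_trans ?_ (P.le_spectralGap (hpoinc (-κ i₀) hmin))
  obtain ⟨X, hX, hX0, hLX⟩ := P.exists_isSelfAdjoint_eigenvector (hb0 i₀) (hb i₀)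
  obtain ⟨⟨σ, hσ⟩, -⟩ := hP
  obtain ⟨hpos, htr⟩ := P.sigmaTr_faithful hσ
  refine P.logSobolevConst_le_of_eigenvector hpos htr hX hX0 hμ (fun Y => ?_) (fun Y => ?_)
    (fun Y => ?_) (fun Y => ?_)
  · rw [← hsym, P.generator_one]
    simp [QMS.kms, QMS.tr]
  · rw [← hsym, hLX, ← QMS.star_kms, QMS.kms_smul_right, star_mul', QMS.star_kms]
    simp
  · rw [hkms, hkms 1 Y]
    refine Finset.sum_congr rfl fun i _ => ?_
    rw [hE]
    split_ifs with h0
    · rfl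
    · have h1 := hL i 1
      rw [P.generator_one] at h1
      have h2 : QMS.kms P.sigmaTr (b i) 0 = 0 := by simp [QMS.kms, QMS.tr]
      rw [h2] at h1
      rw [(mul_eq_zero.mp h1.symm).resolve_left (Complex.ofReal_ne_zero.mpr h0)]
      simp
  · rw [hkms]
    refine Finset.sum_eq_zero fun i _ => ?_
    rw [hE]
    split_ifs with h0
    · have h1 := hL i X
      rw [hLX, QMS.kms_smul_right, h0, Complex.ofReal_zero, zero_mul] at h1
      rw [(mul_eq_zero.mp h1).resolve_left (Complex.ofReal_ne_zero.mpr hi₀)]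
      simp
    · exact mul_zero _
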